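/- **Setting.** Let $n\ge 1$, let $\|\cdot\|_2$ be the Euclidean norm on $\mathbb R^n$, and let $\|\cdot\|$ be a norm on $\mathbb R^n$ with $\|x\|_2\le\|x\|$ for all $x$ (its unit ball lies in the Euclidean one), with dual norm $\|\cdot\|_*$. Let $Q\subset\mathbb R^n$ be nonempty, convex and compact, and let $d:Q\to\mathbb R$ be a prox-function: continuous, and $1$-strongly convex with respect to $\|\cdot\|$; its prox-diameter is at most $R>0$, i.e. $\max_Q d-\min_Q d\le R^2$. Let $\xi$ be a random element and $f(x)=\mathbb E_\xi f(x,\xi)$, where each $f(\cdot,\xi)$ is differentiable at the points of $Q$ and, for all $x,y\in Q$, $$\|\nabla f(x,\xi)-\nabla f(y,\xi)\|_*\le L\|x-y\|,\qquad \mathbb E_\xi\|\nabla f(x,\xi)-\mathbb E_\xi\nabla f(x,\xi)\|_*^2\le D,$$ with $L>0$, $D\ge0$ (and $f(x,\cdot)$, $\nabla f(x,\cdot)$ measurable and integrable for $x\in Q$). **Oracle.** The independent $\delta$-oracle, asked at a point $x\in Q$ and a direction $s$ with $\|s\|_2=1$, returns $\langle\nabla f(x,\xi),s\rangle+\bar\delta$.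 Realizations are drawn independently from one law. The noise $\bar\delta$ has an unknown distribution, may be dependent on $\xi$ (and on the noises of other calls with the same realization), does not depend on $x$ and $s$, and satisfies $|\bar\delta|\le\delta$ almost surely. Let $1\le k\le n+1$; a method may call the oracle at most $k$ times with one realization ($k=1$: a fresh independent realization for every call). **Methods.** A method is randomized, its randomness being independent of the oracle. In each iteration it chooses one point of $Q$ and a finite batch of directions, depending on its randomness and on the answers obtained in earlier iterations, and calls the oracle at this point with a batch of fresh realizations, at most $k$ times with each; at the end it outputs a point $\hat x\in Q$. The numbers of iterations and calls are fixed in advance. A method may depend on the parameters ($n,k,Q,\varepsilon,p$, on $\|\cdot\|,d,L,D,R$, and in part 2 on $\mu_2$ and the prox-centre), but not on $f$, on the law of $\xi$, on the noise or on $\delta$. **Theorem.** There are absolute constants $C,c>0$ and two families of methods, with parameter $p\in[0,1]$, such that for all parameters as above and all $\varepsilon>0$: 1. *(convex case)* The method of the first family makes at most $$N_1(\varepsilon)=n\max\Big\{C\Big(\frac{LR^2}{\varepsilon}\Big)^{\frac1{p+1}},\ C\,\frac{DR^2}{\varepsilon^2}\Big\}$$ oracle calls in at most $\frac nk\,C\big(\frac{LR^2}{\varepsilon}\big)^{\frac1{p+1}}$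 iterations, and $\mathbb E f(\hat x)-\min_Q f\le\varepsilon$ for every problem as above with $f$ convex on $Q$ such that $\varepsilon\le LR^2$ or $\mathbb E_\xi\nabla f(x_*,\xi)=0$ for some $x_*\in Q$, and for every oracle noise with $$\delta\le\sqrt{\frac Ln\,c\,\varepsilon\Big(\frac{\varepsilon}{LR^2}\Big)^{\frac p{p+1}}}.$$ 2. *(strongly convex case)* Let $\|\cdot\|=\|\cdot\|_2$, $d(x)=\frac12\|x-x_0\|_2^2$ for some $x_0\in\mathbb R^n$, and write $L_2,D_2,R_2$ for $L,D,R$; let $\mu_2>0$. The method of the second family makes at most $$N_2(\varepsilon)=n\max\Big\{C\Big(\frac{L_2}{\mu_2}\Big)^{\frac1{p+1}}\max\Big\{1,\Big\lceil\ln\frac{\mu_2R_2^2}{\varepsilon}\Big\rceil\Big\},\ C\,\frac{D_2}{\mu_2\varepsilon}\Big\}$$ oracle calls in at most $\frac nk\,C\big(\frac{L_2}{\mu_2}\big)^{\frac1{p+1}}\max\{1,\lceil\ln\frac{\mu_2R_2^2}{\varepsilon}\rceil\}$ iterations, and $\mathbb E f(\hat x)-\min_Q f\le\varepsilon$ for every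 problem as above with $f$ $\mu_2$-strongly convex on $Q$ in $\|\cdot\|_2$, and for every oracle noise with $$\delta\le\sqrt{\frac{L_2}n\,c\,\varepsilon\Big(\frac{\mu_2}{L_2}\Big)^{\frac p{p+1}}}.$$ -/

import Mathlib

open MeasureTheory

noncomputable section

namespace DirOracle

/-- `ℝⁿ` with the Euclidean norm (the "2-norm"). -/
abbrev Space (n : ℕ) : Type := EuclideanSpace ℝ (Fin n)

/-- The norm dual to `N`: `‖g‖_* = sup {⟨g, x⟩ : N x ≤ 1}`. -/
def dualNorm {n : ℕ} (N : Seminorm ℝ (Space n)) (g : Space n) : ℝ :=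
  sSup {r : ℝ | ∃ x : Space n, N x ≤ 1 ∧ r = inner ℝ g x}

/-- A prox-function (distance generating function) on `Q`: continuous on `Q` and `1`-strongly convex
on `Q` with respect to `N`. -/
structure IsProxFunction {n : ℕ} (N : Seminorm ℝ (Space n)) (Q : Set (Space n))
    (d : Space n → ℝ) : Prop where
  continuousOn : ContinuousOn d Q
  strongConvex : ∀ x ∈ Q, ∀ y ∈ Q, ∀ a b : ℝ, 0 ≤ a → 0 ≤ b → a + b = 1 →
    d (a • x + b • y) ≤ a * d x + b * d y - a * b / 2 * N (x - y) ^ 2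

/-- The prox-diameter of `Q` is at most `R`: `max_Q d - min_Q d ≤ R²`. -/
def ProxDiameterLE {n : ℕ} (Q : Set (Space n)) (d : Space n → ℝ) (R : ℝ) : Prop :=
  ∀ x ∈ Q, ∀ y ∈ Q, d x - d y ≤ R ^ 2

/-- The Euclidean prox-function with centre `c`. -/
def euclideanProx {n : ℕ} (c : Space n) (x : Space n) : ℝ := ‖x - c‖ ^ 2 / 2

/-- The objective `f(x) = E_ξ f(x, ξ)`. -/
def objective {n : ℕ} {Ξ : Type*} [MeasurableSpace Ξ] (P : Measure Ξ) (f : Space n → Ξ → ℝ)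
    (x : Space n) : ℝ :=
  ∫ ξ, f x ξ ∂P

/-- The stochastic gradient `∇f(x, ξ)` (in the variable `x`). -/
def stochGrad {n : ℕ} {Ξ : Type*} (f : Space n → Ξ → ℝ) (x : Space n) (ξ : Ξ) : Space n :=
  gradient (fun y => f y ξ) x

/-- The mean gradient `E_ξ ∇f(x, ξ)`. -/
def meanGrad {n : ℕ} {Ξ : Type*} [MeasurableSpace Ξ] (P : Measure Ξ) (f : Space n → Ξ → ℝ)
    (x : Space n) : Space n :=
  ∫ ξ, stochGrad f x ξ ∂P

/-- The standing assumptions on the integrand: on `Q` every realization is differentiable with an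
`L`-Lipschitz gradient, and the variance of the stochastic gradient is at most `D`
(with respect to the norm `N` and its dual norm). -/
structure IsSmoothStochastic {n : ℕ} {Ξ : Type*} [MeasurableSpace Ξ] (N : Seminorm ℝ (Space n))
    (Q : Set (Space n)) (L D : ℝ) (P : Measure Ξ) (f : Space n → Ξ → ℝ) : Prop where
  integrable : ∀ x ∈ Q, Integrable (f x) P
  differentiableAt : ∀ ξ, ∀ x ∈ Q, DifferentiableAt ℝ (fun y => f y ξ) x
  measurable_grad : ∀ x ∈ Q, Measurable (stochGrad f x)
  integrable_grad : ∀ x ∈ Q, Integrable (stochGrad f x) P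
  lipschitz_grad : ∀ ξ, ∀ x ∈ Q, ∀ y ∈ Q,
    dualNorm N (stochGrad f x ξ - stochGrad f y ξ) ≤ L * N (x - y)
  variance_le : ∀ x ∈ Q,
    ∫⁻ ξ, ENNReal.ofReal (dualNorm N (stochGrad f x ξ - meanGrad P f x) ^ 2) ∂P ≤ ENNReal.ofReal D

/-- The law `ν` of one realization of the independent `δ`-oracle: a draw `ξ ∼ P` together with the
noises added to the (at most `k`) answers that are given with this `ξ`. The noises have an arbitrary
joint distribution with `ξ` and with each other, and are bounded by `δ`. They do not depend on
the queried points and directions. -/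
structure IsOracleLaw {Ξ : Type*} [MeasurableSpace Ξ] (k : ℕ) (P : Measure Ξ) (δ : ℝ)
    (ν : Measure (Ξ × (Fin k → ℝ))) : Prop where
  map_fst : ν.map Prod.fst = P
  noise_le : ∀ᵐ w ∂ν, ∀ i, |w.2 i| ≤ δ

/-- The table of the answers seen so far: entry `t j i` is the answer to the `i`-th call with the
`j`-th realization of iteration `t` (and `0` if there has been no such call). -/
abbrev Record (k : ℕ) : Type := ℕ → ℕ → Fin k → ℝ

/-- A (randomized) method on `Q` that uses at most `k` calls per realization. In iteration `t` it
chooses, from its own random seed and the answers of the earlier iterations, one point of `Q` and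
directions of Euclidean length one; it then calls the oracle at this point with
`realizations t` fresh realizations, `calls t j` times with the `j`-th of them. After the last
iteration it outputs a point of `Q`. -/
structure Method (n k : ℕ) (Q : Set (Space n)) where
  Seed : Type
  [measurableSpaceSeed : MeasurableSpace Seed]
  seedLaw : Measure Seed
  [isProbabilityMeasure_seedLaw : IsProbabilityMeasure seedLaw]
  iterations : ℕ
  realizations : ℕ → ℕ
  calls : ℕ → ℕ → ℕ
  calls_le : ∀ t j, calls t j ≤ k
  point : ℕ → Seed → Record k → Space n
  direction : ℕ → ℕ → Fin k → Seed → Record k → Space n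
  output : Seed → Record k → Space n
  measurable_point : ∀ t, Measurable (fun q : Seed × Record k => point t q.1 q.2)
  measurable_direction : ∀ t j i,
    Measurable (fun q : Seed × Record k => direction t j i q.1 q.2)
  measurable_output : Measurable (fun q : Seed × Record k => output q.1 q.2)
  point_mem : ∀ t u h, point t u h ∈ Q
  norm_direction : ∀ t j i u h, ‖direction t j i u h‖ = 1
  output_mem : ∀ u h, output u h ∈ Q

attribute [instance] Method.measurableSpaceSeed Method.isProbabilityMeasure_seedLaw

namespace Method

variable {n k : ℕ} {Q : Set (Space n)}

/-- The total number of oracle calls. -/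
def totalCalls (M : Method n k Q) : ℕ :=
  ∑ t ∈ Finset.range M.iterations, ∑ j ∈ Finset.range (M.realizations t), M.calls t j

/-- The answers seen before iteration `t`, when the seed is `u` and the `j`-th realization of
iteration `t` is `w (t, j)`. The answer to a call at `x` in direction `s` is
`⟨∇f(x, ξ), s⟩ +` noise. -/
def record {Ξ : Type*} (M : Method n k Q) (f : Space n → Ξ → ℝ) (u : M.Seed)
    (w : ℕ × ℕ → Ξ × (Fin k → ℝ)) : ℕ → Record k
  | 0 => fun _ _ _ => 0
  | t + 1 => fun t' j i =>
      if t' = t ∧ j < M.realizations t ∧ (i : ℕ) < M.calls t j then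
        inner ℝ (stochGrad f (M.point t u (M.record f u w t)) (w (t, j)).1)
          (M.direction t j i u (M.record f u w t)) + (w (t, j)).2 i
      else M.record f u w t t' j i

/-- The point returned by the method. -/
def result {Ξ : Type*} (M : Method n k Q) (f : Space n → Ξ → ℝ)
    (q : M.Seed × (ℕ × ℕ → Ξ × (Fin k → ℝ))) : Space n :=
  M.output q.1 (M.record f q.1 q.2 M.iterations)

/-- The joint law of the seed and of the realizations: the realizations are independent with
law `ν`, and the seed is independent of them. -/
def law {Ξ : Type*} [MeasurableSpace Ξ] (M : Method n k Q) (ν : Measure (Ξ × (Fin k → ℝ)))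
    [IsProbabilityMeasure ν] : Measure (M.Seed × (ℕ × ℕ → Ξ × (Fin k → ℝ))) :=
  M.seedLaw.prod (Measure.infinitePi (fun _ : ℕ × ℕ => ν))

/-- The method has expected accuracy `ε`: `E f(x_N) - min_Q f ≤ ε`. -/
def HasAccuracy {Ξ : Type*} [MeasurableSpace Ξ] (M : Method n k Q) (P : Measure Ξ)
    (f : Space n → Ξ → ℝ) (ν : Measure (Ξ × (Fin k → ℝ))) [IsProbabilityMeasure ν]
    (ε : ℝ) : Prop :=
  Integrable (fun q => objective P f (M.result f q)) (M.law ν) ∧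
    ∀ z ∈ Q, (∫ q, objective P f (M.result f q) ∂(M.law ν)) - objective P f z ≤ ε

end Method

end DirOracle

end

/-!
Both families consist of one method, accelerated dual averaging with mini-batches, run with different
step sizes and batch sizes.

*Gradient estimates.* The Euclidean coordinate directions do not serve a general norm `N`: the
variance is bounded in the dual norm only, and with one call per realization the coordinates of the
estimate come from independent realizations. Instead, `2n` vectors `w j` are chosen in the dual unit
ball so as to maximize the determinant of `A = ∑ w j (w j)ᵀ`. As no exchange of one vector increases
the determinant, `⟨ζ, A⁻¹ ζ⟩ ≤ ‖ζ‖_*²` for all `ζ` (`exists_design`). With `p j = A⁻¹ w j`, the sum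
`∑ ⟨∇f(x, ξ_j), p j⟩ w j` recovers a gradient without any sampling error, the squares of its
coefficient errors add up to at most the variance `D`, and `∑ ‖p j‖² ≤ n`, because the Euclidean ball
contains the unit ball of `N`. Hence `2n` calls, one for each realization, suffice, and the bounds hold
for every `k`. Each direction carries a random sign, which is taken back from the answer: since the
noise does not depend on the direction, it turns into a mean-zero error, and it is averaged out by
repetition as well as the variance is.

*Averaging in a general norm.* A dual norm need not have good type constants, so the second moment of
an average cannot be bounded directly. But the minimal value of `β d + ⟨s, ·⟩` is smooth in `s`, and the
errors of a batch can be fed into it one by one (`proxValue_add_sum_ge`); each contributes a term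
that is linear in it, with a coefficient depending on the other errors only through the preceding
ones, and a square. Half of the growth of the prox-problem pays for the smoothness of the objective,
the other half for the errors (`Scheme.Valid.potential_succ_le`).

*Expectation.* Replacing one coordinate of the product space by an independent copy preserves the law
(`measurePreserving_resample`). Hence the linear terms have mean zero, and `T` iterations with weights
`A_t` and batch sizes `b_t` give (`Scheme.Valid.expected_accuracy`)
`A_T (E f(x_T) - f(z)) ≤ 4 L R² + (D + n δ²) / L * ∑ A_{t+1} / b_t`.

*Parameters.* In both cases the number of iterations is the optimal one, that is the one for `p = 1`;
the larger noise that has to be tolerated for `p < 1` is averaged out by batches that are larger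
by a factor `(L R² / ε) ^ (1 / (p + 1) - 1 / 2)` or `(L / μ) ^ (1 / (p + 1) - 1 / 2)`. In the strongly
convex case the weights grow geometrically once they exceed `L / μ`, and the batch sizes grow like
their square roots, so that the total number of calls does not pick up a logarithm in the term with
`D`.
-/

namespace DirOracle

/-! ### Dual norms -/

/-- The unit ball of the norm dual to `N`. -/
def dualBall {n : ℕ} (N : Seminorm ℝ (Space n)) : Set (Space n) :=
  {w | ∀ v, inner ℝ w v ≤ N v}

lemma abs_inner_le_of_mem_dualBall {n : ℕ} {N : Seminorm ℝ (Space n)} {w : Space n}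
    (hw : w ∈ dualBall N) (v : Space n) : |inner ℝ w v| ≤ N v := by
  refine abs_le.2 ⟨?_, hw v⟩
  have := hw (-v)
  rw [inner_neg_right, map_neg_eq_map] at this
  linarith

lemma continuous_seminorm {n : ℕ} (N : Seminorm ℝ (Space n)) : Continuous N :=
  continuousOn_univ.1 (N.convexOn.continuousOn isOpen_univ)

lemma exists_seminorm_le {n : ℕ} (N : Seminorm ℝ (Space n)) :
    ∃ K : ℝ, 0 < K ∧ ∀ x, N x ≤ K * ‖x‖ :=
  N.bound_of_continuous_normedSpace (continuous_seminorm N)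

lemma isCompact_dualBall {n : ℕ} (N : Seminorm ℝ (Space n)) : IsCompact (dualBall N) := by
  obtain ⟨K, hK, hN⟩ := exists_seminorm_le N
  refine Metric.isCompact_of_isClosed_isBounded ?_ ?_
  · simp only [dualBall, Set.ofPred_forall]
    exact isClosed_iInter fun v => isClosed_le (by fun_prop) (by fun_prop)
  · refine (Metric.isBounded_closedBall (x := (0 : Space n)) (r := K)).subset fun w hw => ?_
    rw [mem_closedBall_zero_iff]
    have h1 := (hw w).trans (hN w)
    rw [real_inner_self_eq_norm_sq, sq] at h1
    by_contra! h
    have : 0 < ‖w‖ := hK.trans h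
    nlinarith

lemma inner_le_dualNorm_mul {n : ℕ} {N : Seminorm ℝ (Space n)} (hN : ∀ x, ‖x‖ ≤ N x)
    (g v : Space n) : inner ℝ g v ≤ dualNorm N g * N v := by
  have hb : BddAbove {r : ℝ | ∃ x : Space n, N x ≤ 1 ∧ r = inner ℝ g x} := by
    refine ⟨‖g‖, ?_⟩
    rintro r ⟨x, hx, rfl⟩
    refine (real_inner_le_norm g x).trans ?_
    exact mul_le_of_le_one_right (norm_nonneg _) ((hN x).trans hx)
  rcases (apply_nonneg N v).eq_or_lt with h | h
  · have : v = 0 := norm_le_zero_iff.1 ((hN v).trans h.ge)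
    simp [this]
  · have : inner ℝ g ((N v)⁻¹ • v) ≤ dualNorm N g := by
      refine le_csSup hb ⟨_, ?_, rfl⟩
      rw [map_smul_eq_mul, Real.norm_of_nonneg (by positivity), inv_mul_cancel₀ h.ne']
    rw [inner_smul_right, inv_mul_le_iff₀ h] at this
    linarith

lemma dualNorm_nonneg {n : ℕ} {N : Seminorm ℝ (Space n)} (hN : ∀ x, ‖x‖ ≤ N x) (g : Space n) :
    0 ≤ dualNorm N g := by
  by_contra! h
  have h1 := inner_le_dualNorm_mul hN g g
  have h2 : 0 ≤ inner ℝ g g := real_inner_self_nonneg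
  have h3 : ‖g‖ ≤ 0 := by
    by_contra! h4
    nlinarith [hN g]
  have : g = 0 := norm_le_zero_iff.1 h3
  subst this
  have : dualNorm N (0 : Space n) = 0 := by
    have : {r : ℝ | ∃ x : Space n, N x ≤ 1 ∧ r = inner ℝ (0 : Space n) x} = {0} := by
      ext r
      simp only [inner_zero_left, Set.mem_ofPred_eq, Set.mem_singleton_iff]
      exact ⟨fun ⟨_, _, h⟩ => h, fun h => ⟨0, by simp, h⟩⟩
    rw [dualNorm, this, csSup_singleton]
  linarith

lemma dualNorm_pos {n : ℕ} {N : Seminorm ℝ (Space n)} (hN : ∀ x, ‖x‖ ≤ N x) {g : Space n}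
    (hg : g ≠ 0) : 0 < dualNorm N g := by
  refine (dualNorm_nonneg hN g).lt_of_ne fun h => hg ?_
  have := inner_le_dualNorm_mul hN g g
  rw [← h, zero_mul, real_inner_self_eq_norm_sq] at this
  exact norm_eq_zero.1 (by nlinarith [norm_nonneg g])

lemma abs_inner_le_dualNorm_mul {n : ℕ} {N : Seminorm ℝ (Space n)} (hN : ∀ x, ‖x‖ ≤ N x)
    (g v : Space n) : |inner ℝ g v| ≤ dualNorm N g * N v := by
  refine abs_le.2 ⟨?_, inner_le_dualNorm_mul hN g v⟩
  have := inner_le_dualNorm_mul hN g (-v)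
  rw [inner_neg_right, map_neg_eq_map] at this
  linarith

/-! ### The prox-mapping -/

/-- The prox-mapping: a minimizer over `Q` of `d + ⟨s, ·⟩`. -/
noncomputable def proxMap {n : ℕ} (Q : Set (Space n)) (d : Space n → ℝ) (s : Space n) : Space n :=
  Classical.epsilon fun u => u ∈ Q ∧ IsMinOn (fun v => d v + inner ℝ s v) Q u

section Prox

variable {n : ℕ} {N : Seminorm ℝ (Space n)} {Q : Set (Space n)} {d : Space n → ℝ}

lemma proxMap_spec (hQ : IsCompact Q) (hQn : Q.Nonempty) (hd : ContinuousOn d Q) (s : Space n) :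
    proxMap Q d s ∈ Q ∧ ∀ v ∈ Q,
      d (proxMap Q d s) + inner ℝ s (proxMap Q d s) ≤ d v + inner ℝ s v := by
  have : ∃ u, u ∈ Q ∧ IsMinOn (fun v => d v + inner ℝ s v) Q u :=
    hQ.exists_isMinOn hQn (hd.add (by fun_prop))
  have h := Classical.epsilon_spec this
  exact ⟨h.1, fun v hv => h.2 hv⟩

/-- Quadratic growth of a strongly convex function around its minimizer. -/
lemma proxMap_growth (hQc : Convex ℝ Q) (hQ : IsCompact Q) (hQn : Q.Nonempty)
    (hd : IsProxFunction N Q d) (s : Space n) {v : Space n} (hv : v ∈ Q) :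
    d (proxMap Q d s) + inner ℝ s (proxMap Q d s) + N (v - proxMap Q d s) ^ 2 / 2
      ≤ d v + inner ℝ s v := by
  obtain ⟨hu, hmin⟩ := proxMap_spec hQ hQn hd.continuousOn s
  set u := proxMap Q d s
  -- compare with the point `u + t (v - u)` and let `t` tend to `0`
  have key : ∀ t ∈ Set.Ioo (0 : ℝ) 1, d u + inner ℝ s u + (1 - t) * N (v - u) ^ 2 / 2
      ≤ d v + inner ℝ s v := by
    rintro t ⟨h0, h1⟩
    have h2 := hd.strongConvex v hv u hu t (1 - t) h0.le (by linarith) (by ring)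
    have h3 := hmin _ (hQc hv hu h0.le (by linarith : 0 ≤ 1 - t) (by ring))
    rw [inner_add_right, inner_smul_right, inner_smul_right] at h3
    have h4 : t * (d u + inner ℝ s u + (1 - t) * N (v - u) ^ 2 / 2)
        ≤ t * (d v + inner ℝ s v) := by linarith
    exact le_of_mul_le_mul_left h4 h0
  have hlim : Filter.Tendsto (fun t : ℝ => d u + inner ℝ s u + (1 - t) * N (v - u) ^ 2 / 2)
      (nhdsWithin 0 (Set.Ioi 0)) (nhds (d u + inner ℝ s u + (1 - 0) * N (v - u) ^ 2 / 2)) :=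
    (Continuous.tendsto (by fun_prop) 0).mono_left nhdsWithin_le_nhds
  have := le_of_tendsto hlim (Filter.mem_of_superset (Ioo_mem_nhdsGT one_pos) key)
  simpa using this

lemma continuous_proxMap (hN : ∀ x, ‖x‖ ≤ N x) (hQc : Convex ℝ Q) (hQ : IsCompact Q)
    (hQn : Q.Nonempty) (hd : IsProxFunction N Q d) : Continuous (proxMap Q d) := by
  have hlip : LipschitzWith 1 (proxMap Q d) := by
    refine LipschitzWith.of_dist_le_mul fun s s' => ?_
    rw [dist_eq_norm, dist_eq_norm, NNReal.coe_one, one_mul]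
    have h1 := proxMap_growth hQc hQ hQn hd s (proxMap_spec hQ hQn hd.continuousOn s').1
    have h2 := proxMap_growth hQc hQ hQn hd s' (proxMap_spec hQ hQn hd.continuousOn s).1
    set u := proxMap Q d s
    set u' := proxMap Q d s'
    rw [map_sub_rev] at h1
    have h3 : N (u - u') ^ 2 ≤ ‖s - s'‖ * ‖u - u'‖ := by
      have : inner ℝ (s - s') (u' - u) ≤ ‖s - s'‖ * ‖u - u'‖ := by
        rw [norm_sub_rev u u']; exact real_inner_le_norm _ _
      simp only [inner_sub_left, inner_sub_right] at this
      linarith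
    have h4 := hN (u - u')
    by_contra! h
    have h5 : 0 < ‖u - u'‖ := (norm_nonneg _).trans_lt h
    nlinarith
  exact hlip.continuous

/-- The minimal value of `β d + ⟨s, ·⟩` on `Q`. -/
noncomputable def proxValue (Q : Set (Space n)) (d : Space n → ℝ) (β : ℝ) (s : Space n) : ℝ :=
  β * d (proxMap Q d (β⁻¹ • s)) + inner ℝ s (proxMap Q d (β⁻¹ • s))

lemma proxValue_growth (hQc : Convex ℝ Q) (hQ : IsCompact Q) (hQn : Q.Nonempty)
    (hd : IsProxFunction N Q d) {β : ℝ} (hβ : 0 < β) (s : Space n) {v : Space n} (hv : v ∈ Q) :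
    proxValue Q d β s + β / 2 * N (v - proxMap Q d (β⁻¹ • s)) ^ 2 ≤ β * d v + inner ℝ s v := by
  have h := mul_le_mul_of_nonneg_left (proxMap_growth hQc hQ hQn hd (β⁻¹ • s) hv) hβ.le
  simp only [inner_smul_left, map_inv₀, RCLike.conj_to_real, mul_add,
    mul_inv_cancel_left₀ hβ.ne'] at h
  rw [proxValue]
  linarith

lemma proxValue_le (hQc : Convex ℝ Q) (hQ : IsCompact Q) (hQn : Q.Nonempty)
    (hd : IsProxFunction N Q d) {β : ℝ} (hβ : 0 < β) (s : Space n) {v : Space n} (hv : v ∈ Q) :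
    proxValue Q d β s ≤ β * d v + inner ℝ s v := by
  have := proxValue_growth hQc hQ hQn hd hβ s hv
  have : 0 ≤ β / 2 * N (v - proxMap Q d (β⁻¹ • s)) ^ 2 := by positivity
  linarith

/-- Smoothness of the minimal value along a direction of the dual unit ball. -/
lemma proxValue_add_smul_ge (hQc : Convex ℝ Q) (hQ : IsCompact Q) (hQn : Q.Nonempty)
    (hd : IsProxFunction N Q d) {β : ℝ} (hβ : 0 < β) (s : Space n) {w : Space n}
    (hw : w ∈ dualBall N) (a : ℝ) :
    proxValue Q d β s + a * inner ℝ w (proxMap Q d (β⁻¹ • s)) - a ^ 2 / (2 * β)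
      ≤ proxValue Q d β (s + a • w) := by
  have hu := (proxMap_spec hQ hQn hd.continuousOn (β⁻¹ • (s + a • w))).1
  have h := proxValue_growth hQc hQ hQn hd hβ s hu
  have hdef : proxValue Q d β (s + a • w) = β * d (proxMap Q d (β⁻¹ • (s + a • w)))
      + inner ℝ (s + a • w) (proxMap Q d (β⁻¹ • (s + a • w))) := rfl
  rw [hdef]
  set u' := proxMap Q d (β⁻¹ • (s + a • w))
  set u := proxMap Q d (β⁻¹ • s)
  rw [inner_add_left, inner_smul_left, RCLike.conj_to_real]
  have h1 : -(|a| * N (u' - u)) ≤ a * inner ℝ w (u' - u) := by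
    have := neg_abs_le (a * inner ℝ w (u' - u))
    rw [abs_mul] at this
    have := mul_le_mul_of_nonneg_left (abs_inner_le_of_mem_dualBall hw (u' - u)) (abs_nonneg a)
    linarith
  have h2 : 0 ≤ β / 2 * N (u' - u) ^ 2 - |a| * N (u' - u) + a ^ 2 / (2 * β) := by
    have : β / 2 * N (u' - u) ^ 2 - |a| * N (u' - u) + a ^ 2 / (2 * β)
        = (β * N (u' - u) - |a|) ^ 2 / (2 * β) := by
      rw [← sq_abs a]
      field_simp
      ring
    rw [this]
    positivity
  rw [inner_sub_right] at h1
  linarith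

/-- The price of a sum of dual vectors is paid term by term, each time with the prox-point of the
preceding partial sum. -/
lemma proxValue_add_sum_ge (hQc : Convex ℝ Q) (hQ : IsCompact Q) (hQn : Q.Nonempty)
    (hd : IsProxFunction N Q d) {β : ℝ} (hβ : 0 < β) (s : Space n) {w : ℕ → Space n}
    (hw : ∀ j, w j ∈ dualBall N) (a : ℕ → ℝ) (J : ℕ) :
    proxValue Q d β s + ∑ j ∈ Finset.range J,
        (a j * inner ℝ (w j) (proxMap Q d (β⁻¹ • (s + ∑ i ∈ Finset.range j, a i • w i)))
          - a j ^ 2 / (2 * β))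
      ≤ proxValue Q d β (s + ∑ j ∈ Finset.range J, a j • w j) := by
  induction J with
  | zero => simp
  | succ J ih =>
    rw [Finset.sum_range_succ, Finset.sum_range_succ, ← add_assoc s]
    have := proxValue_add_smul_ge hQc hQ hQn hd hβ (s + ∑ j ∈ Finset.range J, a j • w j) (hw J)
      (a J)
    linarith

end Prox

/-! ### A linear-size exact design in the dual unit ball -/

section Design

open Matrix

/-- The matrix with columns `w j`. -/
def columnMatrix {n : ℕ} {ι : Type*} (w : ι → Space n) : Matrix (Fin n) ι ℝ :=
  Matrix.of fun i j => w j i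

lemma columnMatrix_update_mul_transpose {n : ℕ} {ι : Type*} [Fintype ι] [DecidableEq ι]
    (w : ι → Space n) (j : ι) (u : Space n) :
    columnMatrix (Function.update w j u) * (columnMatrix (Function.update w j u))ᵀ
      = columnMatrix w * (columnMatrix w)ᵀ
        + (Matrix.of fun i => ![u i, w j i]) * (Matrix.of ![fun i => u i, fun i => -w j i]) := by
  ext i k
  simp only [Matrix.mul_apply, Matrix.transpose_apply, columnMatrix, Matrix.of_apply,
    Matrix.add_apply, Fin.sum_univ_two, Matrix.cons_val_zero, Matrix.cons_val_one]
  rw [← Finset.add_sum_erase _ _ (Finset.mem_univ j),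
    ← Finset.add_sum_erase Finset.univ (fun l => w l i * w l k) (Finset.mem_univ j)]
  have : ∑ x ∈ Finset.univ.erase j, (Function.update w j u x) i * (Function.update w j u x) k
      = ∑ x ∈ Finset.univ.erase j, w x i * w x k := by
    refine Finset.sum_congr rfl fun x hx => ?_
    rw [Function.update_of_ne (Finset.ne_of_mem_erase hx)]
  rw [this, Function.update_self]
  ring

/-- Exchanging one vector for another changes the determinant of the Gram-type matrix by a factor
that is quadratic in the vectors. -/
lemma det_columnMatrix_update {n : ℕ} {ι : Type*} [Fintype ι] [DecidableEq ι]
    (w : ι → Space n) (j : ι) (u : Space n)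
    (hA : IsUnit (columnMatrix w * (columnMatrix w)ᵀ).det) :
    (columnMatrix (Function.update w j u) * (columnMatrix (Function.update w j u))ᵀ).det
      = (columnMatrix w * (columnMatrix w)ᵀ).det *
        ((1 + u.ofLp ⬝ᵥ (columnMatrix w * (columnMatrix w)ᵀ)⁻¹ *ᵥ u.ofLp)
          * (1 - (w j).ofLp ⬝ᵥ (columnMatrix w * (columnMatrix w)ᵀ)⁻¹ *ᵥ (w j).ofLp)
          + (u.ofLp ⬝ᵥ (columnMatrix w * (columnMatrix w)ᵀ)⁻¹ *ᵥ (w j).ofLp) ^ 2) := by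
  set A := columnMatrix w * (columnMatrix w)ᵀ with hAdef
  have hsymm : (A⁻¹)ᵀ = A⁻¹ := by
    rw [Matrix.transpose_nonsing_inv, hAdef, Matrix.transpose_mul, Matrix.transpose_transpose]
  have hsw : (w j).ofLp ⬝ᵥ A⁻¹ *ᵥ u.ofLp = u.ofLp ⬝ᵥ A⁻¹ *ᵥ (w j).ofLp := by
    rw [Matrix.dotProduct_mulVec, ← Matrix.mulVec_transpose, hsymm, dotProduct_comm]
  rw [columnMatrix_update_mul_transpose, ← hAdef, Matrix.det_add_mul _ _ hA]
  congr 1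
  have hent : ∀ x y : Fin n → ℝ,
      ∑ k, (∑ i, x i * A⁻¹ i k) * y k = x ⬝ᵥ A⁻¹ *ᵥ y := by
    intro x y
    rw [Matrix.dotProduct_mulVec]
    rfl
  have hneg : (fun i => -(w j).ofLp i) = -(w j).ofLp := rfl
  rw [Matrix.det_fin_two]
  simp only [Matrix.add_apply, Matrix.mul_apply, Matrix.of_apply, Matrix.cons_val_zero,
    Matrix.cons_val_one, Matrix.one_apply_eq, hent, hneg,
    neg_dotProduct, hsw]
  rw [Matrix.one_apply_ne (by decide), Matrix.one_apply_ne (by decide)]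
  ring

lemma inner_eq_dotProduct {n : ℕ} (x y : Space n) : inner ℝ x y = x.ofLp ⬝ᵥ y.ofLp := by
  rw [EuclideanSpace.inner_eq_star_dotProduct, star_trivial, dotProduct_comm]

lemma single_mem_dualBall {n : ℕ} {N : Seminorm ℝ (Space n)} (hN : ∀ x, ‖x‖ ≤ N x) (i : Fin n) :
    EuclideanSpace.single i (1 : ℝ) ∈ dualBall N := fun v =>
  (real_inner_le_norm _ _).trans (by simpa using hN v)

/-- An exact design of linear size: `2n` vectors `w j` of the dual unit ball and vectors `p j` with
`∑ ⟨g, p j⟩ w j = g` for all `g`, such that the coefficients of `ζ` have square sum at most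
`‖ζ‖_*²`. The `w j` are chosen to maximize the determinant of `A = ∑ w j (w j)ᵀ`, and
`p j = A⁻¹ w j`. -/
lemma exists_design {n : ℕ} {N : Seminorm ℝ (Space n)} (hN : ∀ x, ‖x‖ ≤ N x) :
    ∃ w p : Fin n ⊕ Fin n → Space n, (∀ j, w j ∈ dualBall N) ∧
      (∀ g : Space n, ∑ j, (inner ℝ g (p j) : ℝ) • w j = g) ∧
      (∀ ζ : Space n, ∑ j, (inner ℝ ζ (p j) : ℝ) ^ 2 ≤ dualNorm N ζ ^ 2) ∧
      ∑ j, ‖p j‖ ^ 2 ≤ n := by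
  classical
  set gram : (Fin n ⊕ Fin n → Space n) → Matrix (Fin n) (Fin n) ℝ :=
    fun w => columnMatrix w * (columnMatrix w)ᵀ with hgram
  have hcont : Continuous fun w => (gram w).det := by
    refine Continuous.matrix_det (Continuous.matrix_mul ?_ (Continuous.matrix_transpose ?_)) <;>
      exact continuous_matrix fun i j => by simp only [columnMatrix, Matrix.of_apply]; fun_prop
  have h0 : (0 : Space n) ∈ dualBall N := fun v => by simp
  obtain ⟨w, hwmem, hwmax⟩ := (isCompact_univ_pi
    (fun _ : Fin n ⊕ Fin n => isCompact_dualBall N)).exists_isMaxOn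
    ⟨fun _ => 0, fun _ _ => h0⟩ hcont.continuousOn
  have hw : ∀ j, w j ∈ dualBall N := fun j => hwmem j trivial
  have hdet : 0 < (gram w).det := by
    -- the standard basis padded with zeros is a competitor with determinant one
    set e : Fin n ⊕ Fin n → Space n :=
      Sum.elim (fun i => EuclideanSpace.single i (1 : ℝ)) (fun _ => 0) with he
    have h1 : (gram e).det ≤ (gram w).det := by
      refine hwmax fun j _ => ?_
      rcases j with i | i
      · exact single_mem_dualBall hN i
      · exact h0
    have h2 : gram e = 1 := by
      ext i k
      simp [hgram, he, columnMatrix, Matrix.mul_apply, Matrix.one_apply]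
    rw [h2, Matrix.det_one] at h1
    linarith
  have hunit : IsUnit (gram w).det := hdet.ne'.isUnit
  set A := gram w with hA
  have hsymm : (A⁻¹)ᵀ = A⁻¹ := by
    rw [Matrix.transpose_nonsing_inv, hA, hgram, Matrix.transpose_mul,
      Matrix.transpose_transpose]
  set p : Fin n ⊕ Fin n → Space n := fun j => WithLp.toLp 2 (A⁻¹ *ᵥ (w j).ofLp) with hp
  have hip : ∀ (g : Space n) j, inner ℝ g (p j) = g.ofLp ⬝ᵥ A⁻¹ *ᵥ (w j).ofLp := fun g j => by
    rw [inner_eq_dotProduct]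
  have hip' : ∀ (g : Space n) j, inner ℝ g (p j) = (w j).ofLp ⬝ᵥ A⁻¹ *ᵥ g.ofLp := fun g j => by
    rw [hip, Matrix.dotProduct_mulVec, ← Matrix.mulVec_transpose, hsymm, dotProduct_comm]
  have hrec : ∀ g : Space n, ∑ j, (inner ℝ g (p j) : ℝ) • w j = g := by
    intro g
    have h1 : A *ᵥ (A⁻¹ *ᵥ g.ofLp) = g.ofLp := by
      rw [Matrix.mulVec_mulVec, Matrix.mul_nonsing_inv _ hunit, Matrix.one_mulVec]
    ext i
    rw [← congrFun h1 i, hA, hgram]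
    simp only [← Matrix.mulVec_mulVec, WithLp.ofLp_sum, Finset.sum_apply, WithLp.ofLp_smul,
      Pi.smul_apply, smul_eq_mul, hip']
    rw [Matrix.mulVec]
    refine Finset.sum_congr rfl fun j _ => ?_
    rw [mul_comm]
    rfl
  have htr : ∑ j, (inner ℝ (w j) (p j) : ℝ) = n := by
    have h1 : (A⁻¹ * A).trace = n := by
      rw [Matrix.nonsing_inv_mul _ hunit, Matrix.trace_one, Fintype.card_fin]
    rw [← h1, hA, hgram, ← Matrix.mul_assoc, Matrix.trace_mul_comm, Matrix.trace]
    refine Finset.sum_congr rfl fun j _ => ?_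
    rw [hip]
    rfl
  have hsq : ∀ ζ : Space n, ∑ j, (inner ℝ ζ (p j) : ℝ) ^ 2 = ζ.ofLp ⬝ᵥ A⁻¹ *ᵥ ζ.ofLp := by
    intro ζ
    have h1 := congrArg (fun x => inner ℝ x (WithLp.toLp 2 (A⁻¹ *ᵥ ζ.ofLp) : Space n)) (hrec ζ)
    simp only [sum_inner, inner_smul_left, RCLike.conj_to_real] at h1
    rw [inner_eq_dotProduct ζ] at h1
    rw [← h1]
    refine Finset.sum_congr rfl fun j _ => ?_
    rw [inner_eq_dotProduct (w j), ← hip', sq]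
  -- no exchange of a `w j` for a vector of the dual ball increases the determinant;
  -- these inequalities are summed over `j`
  have hball : ∀ ζ ∈ dualBall N, ∑ j, (inner ℝ ζ (p j) : ℝ) ^ 2 ≤ 1 := by
    intro ζ hζ
    have hex : ∀ j, (1 + ζ.ofLp ⬝ᵥ A⁻¹ *ᵥ ζ.ofLp) * (1 - inner ℝ (w j) (p j))
        + (inner ℝ ζ (p j) : ℝ) ^ 2 ≤ 1 := by
      intro j
      have h1 : (gram (Function.update w j ζ)).det ≤ (gram w).det := by
        refine hwmax fun i _ => ?_
        rcases eq_or_ne i j with rfl | hij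
        · rwa [Function.update_self]
        · rw [Function.update_of_ne hij]; exact hw i
      have h2 := det_columnMatrix_update w j ζ hunit
      rw [hip, hip]
      refine le_of_mul_le_mul_left ?_ hdet
      rw [mul_one]
      exact h2.symm.trans_le h1
    have hsum := Finset.sum_le_sum fun j (_ : j ∈ Finset.univ) => hex j
    rw [Finset.sum_add_distrib, ← Finset.mul_sum, Finset.sum_sub_distrib, htr, hsq] at hsum
    simp only [Finset.sum_const, Finset.card_univ, Fintype.card_sum, Fintype.card_fin, nsmul_eq_mul,
      mul_one, Nat.cast_add] at hsum
    rw [hsq]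
    by_contra! h
    have : (0 : ℝ) ≤ n := n.cast_nonneg
    nlinarith
  refine ⟨w, p, hw, hrec, fun ζ => ?_, ?_⟩
  · rcases eq_or_ne ζ 0 with rfl | hζ
    · simpa using sq_nonneg _
    · have hpos := dualNorm_pos hN hζ
      have h1 := hball ((dualNorm N ζ)⁻¹ • ζ) fun v => by
        rw [inner_smul_left, map_inv₀, RCLike.conj_to_real, inv_mul_le_iff₀ hpos]
        exact inner_le_dualNorm_mul hN ζ v
      simp only [inner_smul_left, map_inv₀, RCLike.conj_to_real, mul_pow, ← Finset.mul_sum] at h1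
      rwa [inv_pow, inv_mul_le_iff₀ (by positivity), mul_one] at h1
  · have h1 : ∀ j, ‖p j‖ ^ 2
        = ∑ i, (inner ℝ (EuclideanSpace.single i (1 : ℝ)) (p j) : ℝ) ^ 2 := by
      intro j
      rw [EuclideanSpace.real_norm_sq_eq]
      simp [EuclideanSpace.inner_single_left]
    simp only [h1]
    rw [Finset.sum_comm]
    calc _ ≤ ∑ _i : Fin n, (1 : ℝ) :=
          Finset.sum_le_sum fun i _ => hball _ (single_mem_dualBall hN i)
      _ = n := by simp

end Design

/-! ### The objective and its mean gradient -/

section Objective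

variable {n : ℕ} {Ξ : Type*} [MeasurableSpace Ξ] {N : Seminorm ℝ (Space n)} {Q : Set (Space n)}
  {L D : ℝ} {P : Measure Ξ} {f : Space n → Ξ → ℝ}

lemma abs_taylor_remainder_le {h h' : ℝ → ℝ} {M : ℝ}
    (hd : ∀ t ∈ Set.Icc (0 : ℝ) 1, HasDerivAt h (h' t) t)
    (hM : ∀ t ∈ Set.Icc (0 : ℝ) 1, |h' t - h' 0| ≤ M * t) : |h 1 - h 0 - h' 0| ≤ M / 2 := by
  have key := image_norm_le_of_norm_deriv_right_le_deriv_boundary' (a := (0 : ℝ)) (b := 1)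
    (f := fun t => h t - h 0 - t * h' 0) (f' := fun t => h' t - h' 0)
    (B := fun t => M / 2 * t ^ 2) (B' := fun t => M * t) ?_ ?_ ?_ ?_ ?_ ?_
    (Set.right_mem_Icc.2 zero_le_one)
  · simpa using key
  · refine ((ContinuousOn.sub (fun t ht => (hd t ht).continuousAt.continuousWithinAt)
      continuousOn_const).sub (by fun_prop))
  · intro t ht
    have := ((hd t (Set.Ico_subset_Icc_self ht)).sub_const (h 0)).sub
      ((hasDerivAt_id t).mul_const (h' 0))
    exact (this.congr_deriv (by simp)).hasDerivWithinAt
  · simp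
  · fun_prop
  · intro t _
    have := ((hasDerivAt_id t).pow 2).const_mul (M / 2)
    refine (this.congr_deriv ?_).hasDerivWithinAt
    simp
    ring
  · intro t ht
    simpa using hM t (Set.Ico_subset_Icc_self ht)

lemma IsSmoothStochastic.abs_remainder_le (hN : ∀ x, ‖x‖ ≤ N x) (hQ : Convex ℝ Q)
    (hf : IsSmoothStochastic N Q L D P f) (ξ : Ξ) {x y : Space n} (hx : x ∈ Q) (hy : y ∈ Q) :
    |f y ξ - f x ξ - inner ℝ (stochGrad f x ξ) (y - x)| ≤ L / 2 * N (y - x) ^ 2 := by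
  have hmem : ∀ t ∈ Set.Icc (0 : ℝ) 1, x + t • (y - x) ∈ Q := fun t ht =>
    hQ.add_smul_sub_mem hx hy ht
  have := abs_taylor_remainder_le (h := fun t => f (x + t • (y - x)) ξ)
    (h' := fun t => inner ℝ (stochGrad f (x + t • (y - x)) ξ) (y - x))
    (M := L * N (y - x) ^ 2) ?_ ?_
  · simp only [one_smul, zero_smul, add_zero, add_sub_cancel] at this
    linarith
  · intro t ht
    have h1 := (hf.differentiableAt ξ _ (hmem t ht)).hasGradientAt.hasFDerivAt
    have h2 : HasDerivAt (fun t : ℝ => x + t • (y - x)) (y - x) t := by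
      simpa using ((hasDerivAt_id t).smul_const (y - x)).const_add x
    have h3 := h1.comp_hasDerivAt t h2
    exact h3.congr_deriv (by simp [stochGrad])
  · intro t ht
    rw [zero_smul, add_zero, ← inner_sub_left]
    refine (abs_inner_le_dualNorm_mul hN _ _).trans ?_
    have h1 := hf.lipschitz_grad ξ _ (hmem t ht) x hx
    rw [add_sub_cancel_left, map_smul_eq_mul, Real.norm_of_nonneg ht.1] at h1
    have := mul_le_mul_of_nonneg_right h1 (apply_nonneg N (y - x))
    linarith

lemma IsSmoothStochastic.exists_lipschitz (hN : ∀ x, ‖x‖ ≤ N x) (hL : 0 < L)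
    (hf : IsSmoothStochastic N Q L D P f) :
    ∃ K : ℝ, ∀ ξ, ∀ x ∈ Q, ∀ y ∈ Q, ‖stochGrad f x ξ - stochGrad f y ξ‖ ≤ K * ‖x - y‖ := by
  obtain ⟨K, hK, hNK⟩ := exists_seminorm_le N
  refine ⟨L * K * K, fun ξ x hx y hy => ?_⟩
  set v := stochGrad f x ξ - stochGrad f y ξ
  have h1 := inner_le_dualNorm_mul hN v v
  rw [real_inner_self_eq_norm_sq] at h1
  have h2 : dualNorm N v ≤ L * K * ‖x - y‖ := by
    refine (hf.lipschitz_grad ξ x hx y hy).trans ?_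
    rw [mul_assoc]
    exact mul_le_mul_of_nonneg_left (hNK _) hL.le
  have h3 : dualNorm N v * N v ≤ (L * K * ‖x - y‖) * (K * ‖v‖) :=
    mul_le_mul h2 (hNK v) (apply_nonneg N v) (by positivity)
  rcases (norm_nonneg v).eq_or_lt with h | h
  · rw [← h]; positivity
  · refine le_of_mul_le_mul_right ?_ h
    linarith

lemma IsSmoothStochastic.continuous_stochGrad (hN : ∀ x, ‖x‖ ≤ N x) (hL : 0 < L)
    (hf : IsSmoothStochastic N Q L D P f) (ξ : Ξ) :
    Continuous fun x : Q => stochGrad f x ξ := by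
  obtain ⟨K, hK⟩ := hf.exists_lipschitz hN hL
  refine (LipschitzWith.of_dist_le_mul (K := K.toNNReal) fun x y => ?_).continuous
  rw [dist_eq_norm, Subtype.dist_eq, dist_eq_norm]
  exact (hK ξ x x.2 y y.2).trans (mul_le_mul_of_nonneg_right (Real.le_coe_toNNReal K)
    (norm_nonneg _))

lemma IsSmoothStochastic.continuous_meanGrad [IsProbabilityMeasure P] (hN : ∀ x, ‖x‖ ≤ N x)
    (hL : 0 < L) (hf : IsSmoothStochastic N Q L D P f) :
    Continuous fun x : Q => meanGrad P f x := by
  obtain ⟨K, hK⟩ := hf.exists_lipschitz hN hL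
  refine (LipschitzWith.of_dist_le_mul (K := K.toNNReal) fun x y => ?_).continuous
  rw [dist_eq_norm, Subtype.dist_eq, dist_eq_norm, meanGrad, meanGrad,
    ← integral_sub (hf.integrable_grad x x.2) (hf.integrable_grad y y.2)]
  refine (norm_integral_le_of_norm_le_const (Filter.Eventually.of_forall fun ξ =>
    hK ξ x x.2 y y.2)).trans ?_
  rw [probReal_univ, mul_one]
  exact mul_le_mul_of_nonneg_right (Real.le_coe_toNNReal K) (norm_nonneg _)

lemma IsSmoothStochastic.integral_inner_stochGrad (hf : IsSmoothStochastic N Q L D P f)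
    {x : Space n} (hx : x ∈ Q) (v : Space n) :
    ∫ ξ, inner ℝ (stochGrad f x ξ) v ∂P = inner ℝ (meanGrad P f x) v := by
  simp only [real_inner_comm v]
  rw [integral_inner (hf.integrable_grad x hx) v]
  rfl

lemma IsSmoothStochastic.abs_objective_remainder_le [IsProbabilityMeasure P]
    (hN : ∀ x, ‖x‖ ≤ N x) (hQ : Convex ℝ Q) (hf : IsSmoothStochastic N Q L D P f) {x y : Space n}
    (hx : x ∈ Q) (hy : y ∈ Q) :
    |objective P f y - objective P f x - inner ℝ (meanGrad P f x) (y - x)|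
      ≤ L / 2 * N (y - x) ^ 2 := by
  have hi : Integrable (fun ξ => inner ℝ (stochGrad f x ξ) (y - x)) P :=
    (hf.integrable_grad x hx).inner_const _
  have hi' : Integrable (fun ξ => f y ξ - f x ξ) P := (hf.integrable y hy).sub (hf.integrable x hx)
  rw [← hf.integral_inner_stochGrad hx, objective, objective,
    ← integral_sub (hf.integrable y hy) (hf.integrable x hx), ← integral_sub hi' hi]
  have := norm_integral_le_of_norm_le_const (μ := P)
    (f := fun ξ => f y ξ - f x ξ - inner ℝ (stochGrad f x ξ) (y - x))
    (Filter.Eventually.of_forall fun ξ => hf.abs_remainder_le hN hQ ξ hx hy)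
  simpa using this

lemma IsSmoothStochastic.continuous_objective [IsProbabilityMeasure P] (hN : ∀ x, ‖x‖ ≤ N x)
    (hQ : Convex ℝ Q) (hf : IsSmoothStochastic N Q L D P f) :
    Continuous fun x : Q => objective P f x := by
  rw [continuous_iff_continuousAt]
  intro x
  have h1 : Filter.Tendsto (fun y : Q => objective P f y - objective P f x
      - inner ℝ (meanGrad P f x) ((y : Space n) - x)) (nhds x) (nhds 0) := by
    refine squeeze_zero_norm (fun y => hf.abs_objective_remainder_le hN hQ x.2 y.2) ?_
    have hc : Continuous fun y : Q => L / 2 * N ((y : Space n) - x) ^ 2 := by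
      have := continuous_seminorm N
      fun_prop
    simpa using hc.tendsto x
  have h2 : Filter.Tendsto (fun y : Q => objective P f x
      + inner ℝ (meanGrad P f x) ((y : Space n) - x)) (nhds x) (nhds (objective P f x)) := by
    have hc : Continuous fun y : Q => objective P f x
      + inner ℝ (meanGrad P f x) ((y : Space n) - x) := by fun_prop
    simpa using hc.tendsto x
  have := h1.add h2
  rw [zero_add] at this
  refine this.congr fun y => ?_
  ring

/-- First-order characterization of (strong) convexity of the objective, with the mean gradient. -/
lemma IsSmoothStochastic.objective_ge [IsProbabilityMeasure P] (hN : ∀ x, ‖x‖ ≤ N x)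
    (hQ : Convex ℝ Q) (hf : IsSmoothStochastic N Q L D P f) {m : ℝ}
    (hm : StrongConvexOn Q m (objective P f)) {x z : Space n} (hx : x ∈ Q) (hz : z ∈ Q) :
    objective P f x + inner ℝ (meanGrad P f x) (z - x) + m / 2 * ‖z - x‖ ^ 2
      ≤ objective P f z := by
  have key : ∀ t ∈ Set.Ioo (0 : ℝ) 1, objective P f x + inner ℝ (meanGrad P f x) (z - x)
      + (1 - t) * (m / 2 * ‖z - x‖ ^ 2) - t * (L / 2 * N (z - x) ^ 2) ≤ objective P f z := by
    rintro t ⟨h0, h1⟩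
    have h2 := hm.2 hz hx h0.le (by linarith : 0 ≤ 1 - t) (by ring)
    have h3 := (abs_le.1 (hf.abs_objective_remainder_le hN hQ hx
      (hQ hz hx h0.le (by linarith : 0 ≤ 1 - t) (by ring)))).1
    have h4 : t • z + (1 - t) • x - x = t • (z - x) := by module
    rw [h4, map_smul_eq_mul, Real.norm_of_nonneg h0.le, inner_smul_right] at h3
    simp only [smul_eq_mul] at h2
    refine le_of_mul_le_mul_left ?_ h0
    nlinarith
  have hlim : Filter.Tendsto (fun t : ℝ => objective P f x + inner ℝ (meanGrad P f x) (z - x)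
      + (1 - t) * (m / 2 * ‖z - x‖ ^ 2) - t * (L / 2 * N (z - x) ^ 2))
      (nhdsWithin 0 (Set.Ioi 0)) (nhds (objective P f x + inner ℝ (meanGrad P f x) (z - x)
      + (1 - 0) * (m / 2 * ‖z - x‖ ^ 2) - 0 * (L / 2 * N (z - x) ^ 2))) :=
    (Continuous.tendsto (by fun_prop) 0).mono_left nhdsWithin_le_nhds
  have := le_of_tendsto hlim (Filter.mem_of_superset (Ioo_mem_nhdsGT one_pos) key)
  simpa using this

section Measurability

variable {Ω : Type*} [MeasurableSpace Ω]

lemma IsSmoothStochastic.measurable_stochGrad_comp (hN : ∀ x, ‖x‖ ≤ N x) (hL : 0 < L)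
    (hf : IsSmoothStochastic N Q L D P f) {X : Ω → Space n} {Y : Ω → Ξ} (hX : Measurable X)
    (hXQ : ∀ ω, X ω ∈ Q) (hY : Measurable Y) :
    Measurable fun ω => stochGrad f (X ω) (Y ω) := by
  have h1 : Measurable (Function.uncurry fun (x : Q) (ξ : Ξ) => stochGrad f x ξ) :=
    measurable_uncurry_of_continuous_of_measurable (hf.continuous_stochGrad hN hL)
      fun x => hf.measurable_grad x x.2
  exact h1.comp ((hX.subtype_mk (h := hXQ)).prodMk hY)

lemma IsSmoothStochastic.measurable_meanGrad_comp [IsProbabilityMeasure P] (hN : ∀ x, ‖x‖ ≤ N x)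
    (hL : 0 < L) (hf : IsSmoothStochastic N Q L D P f) {X : Ω → Space n} (hX : Measurable X)
    (hXQ : ∀ ω, X ω ∈ Q) : Measurable fun ω => meanGrad P f (X ω) :=
  (hf.continuous_meanGrad hN hL).measurable.comp (hX.subtype_mk (h := hXQ))

lemma IsSmoothStochastic.integrable_objective_comp [IsProbabilityMeasure P]
    (hN : ∀ x, ‖x‖ ≤ N x) (hQ : Convex ℝ Q) (hQc : IsCompact Q)
    (hf : IsSmoothStochastic N Q L D P f) {κ : Measure Ω} [IsProbabilityMeasure κ]
    {X : Ω → Space n} (hX : Measurable X) (hXQ : ∀ ω, X ω ∈ Q) :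
    Integrable (fun ω => objective P f (X ω)) κ := by
  have hc := hf.continuous_objective hN hQ
  have hm : Measurable fun ω => objective P f (X ω) :=
    hc.measurable.comp (hX.subtype_mk (h := hXQ))
  have : CompactSpace Q := isCompact_iff_compactSpace.1 hQc
  obtain ⟨K, hK⟩ := isCompact_univ.exists_bound_of_continuousOn hc.continuousOn
  exact Integrable.of_bound hm.aestronglyMeasurable K
    (Filter.Eventually.of_forall fun ω => hK ⟨X ω, hXQ ω⟩ trivial)

end Measurability

end Objective

/-! ### Accelerated dual averaging with inexact gradients -/

/-- The weights `A_t` of the method: they grow at least quadratically, and geometrically with rate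
`1 + q` once `q A_t` exceeds `t + 1`. -/
noncomputable def weight (q : ℝ) : ℕ → ℝ
  | 0 => 0
  | t + 1 => weight q t + max ((t : ℝ) + 1) (q * weight q t)

/-- The increment of the weights, which is the step size of the method. -/
noncomputable def stepSize (q : ℝ) (t : ℕ) : ℝ := max ((t : ℝ) + 1) (q * weight q t)

lemma weight_succ (q : ℝ) (t : ℕ) : weight q (t + 1) = weight q t + stepSize q t := rfl

lemma stepSize_pos (q : ℝ) (t : ℕ) : 0 < stepSize q t :=
  (by positivity : (0 : ℝ) < (t : ℝ) + 1).trans_le (le_max_left _ _)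

lemma weight_ge (q : ℝ) (t : ℕ) : (t : ℝ) * (t + 1) / 2 ≤ weight q t := by
  induction t with
  | zero => simp [weight]
  | succ t ih =>
    have := le_max_left ((t : ℝ) + 1) (q * weight q t)
    rw [weight]
    push_cast
    linarith

lemma weight_nonneg (q : ℝ) (t : ℕ) : 0 ≤ weight q t :=
  (by positivity : (0 : ℝ) ≤ (t : ℝ) * (t + 1) / 2).trans (weight_ge q t)

lemma weight_succ_pos (q : ℝ) (t : ℕ) : 0 < weight q (t + 1) :=
  add_pos_of_nonneg_of_pos (weight_nonneg q t) (stepSize_pos q t)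

lemma monotone_weight (q : ℝ) : Monotone (weight q) :=
  monotone_nat_of_le_succ fun t => by
    rw [weight_succ]; linarith [stepSize_pos q t]

/-- The parameters of the accelerated method: the feasible set `Q`, the prox-function `d`, the
smoothness constant `L`, the strong convexity constant `μ` (with respect to the Euclidean
prox-function with centre `x₀`), and the growth rate `q` of the weights. -/
structure Scheme (n : ℕ) where
  Q : Set (Space n)
  d : Space n → ℝ
  x₀ : Space n
  L : ℝ
  μ : ℝ
  q : ℝ

namespace Scheme

variable {n : ℕ} (S : Scheme n)

/-- The coefficient of the prox-function before iteration `t`. -/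
noncomputable def modulus (t : ℕ) : ℝ := 4 * S.L + S.μ * weight S.q t

/-- The prox-point of the accumulated dual vector `s` before iteration `t`. -/
noncomputable def mirror (t : ℕ) (s : Space n) : Space n :=
  proxMap S.Q S.d ((S.modulus t)⁻¹ • s)

/-- The weighted average of a point of weight `A_t` and a point of weight `A_{t+1} - A_t`. -/
noncomputable def mix (t : ℕ) (y u : Space n) : Space n :=
  (weight S.q t / weight S.q (t + 1)) • y + (stepSize S.q t / weight S.q (t + 1)) • u

/-- The pair of the accumulated dual vector and of the primal point before iteration `t`, when
iteration `i` uses `g i` as the gradient at its query point. -/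
noncomputable def state (g : ℕ → Space n) : ℕ → Space n × Space n
  | 0 => (0, S.mirror 0 0)
  | t + 1 =>
      let s := (state g t).1 + stepSize S.q t • (g t - S.μ •
        (S.mix t (state g t).2 (S.mirror t (state g t).1) - S.x₀))
      (s, S.mix t (state g t).2 (S.mirror (t + 1) s))

/-- The point at which the gradient is estimated in iteration `t`. -/
noncomputable def query (g : ℕ → Space n) (t : ℕ) : Space n :=
  S.mix t (S.state g t).2 (S.mirror t (S.state g t).1)

lemma state_succ_fst (g : ℕ → Space n) (t : ℕ) :
    (S.state g (t + 1)).1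
      = (S.state g t).1 + stepSize S.q t • (g t - S.μ • (S.query g t - S.x₀)) := rfl

lemma state_succ_snd (g : ℕ → Space n) (t : ℕ) :
    (S.state g (t + 1)).2
      = S.mix t (S.state g t).2 (S.mirror (t + 1) (S.state g (t + 1)).1) := rfl

lemma state_congr {g g' : ℕ → Space n} {t : ℕ} (h : ∀ i < t, g i = g' i) :
    S.state g t = S.state g' t := by
  induction t with
  | zero => rfl
  | succ t ih =>
    rw [state, state, ih fun i hi => h i (hi.trans t.lt_succ_self), h t t.lt_succ_self]

lemma query_congr {g g' : ℕ → Space n} {t : ℕ} (h : ∀ i < t, g i = g' i) :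
    S.query g t = S.query g' t := by
  rw [query, query, S.state_congr h]

/-- The geometric assumptions on the parameters. The last two fields say that `μ d` is convex with
gradient `μ (x - x₀)`, and that the steps are short enough for smoothness constant `L`. -/
structure Valid (N : Seminorm ℝ (Space n)) : Prop where
  le_norm : ∀ x, ‖x‖ ≤ N x
  convex : Convex ℝ S.Q
  isCompact : IsCompact S.Q
  nonempty : S.Q.Nonempty
  prox : IsProxFunction N S.Q S.d
  L_pos : 0 < S.L
  μ_nonneg : 0 ≤ S.μ
  q_nonneg : 0 ≤ S.q
  bregman : ∀ x ∈ S.Q, ∀ z ∈ S.Q,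
    0 ≤ S.μ * (S.d z - S.d x - inner ℝ (x - S.x₀) (z - x))
  rate : 2 * S.L * S.q ^ 2 ≤ S.μ

variable {S} {N : Seminorm ℝ (Space n)}

lemma Valid.modulus_pos (hS : S.Valid N) (t : ℕ) : 0 < S.modulus t := by
  have := hS.L_pos
  have := mul_nonneg hS.μ_nonneg (weight_nonneg S.q t)
  unfold modulus
  linarith

lemma Valid.mirror_mem (hS : S.Valid N) (t : ℕ) (s : Space n) : S.mirror t s ∈ S.Q :=
  (proxMap_spec hS.isCompact hS.nonempty hS.prox.continuousOn _).1

lemma Valid.continuous_mirror (hS : S.Valid N) (t : ℕ) : Continuous (S.mirror t) :=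
  (continuous_proxMap hS.le_norm hS.convex hS.isCompact hS.nonempty hS.prox).comp (by fun_prop)

lemma Valid.mix_mem (hS : S.Valid N) (t : ℕ) {y u : Space n} (hy : y ∈ S.Q) (hu : u ∈ S.Q) :
    S.mix t y u ∈ S.Q := by
  have h := weight_succ_pos S.q t
  refine hS.convex hy hu (div_nonneg (weight_nonneg _ _) h.le)
    (div_nonneg (stepSize_pos _ _).le h.le) ?_
  rw [← add_div, ← weight_succ, div_self h.ne']

lemma Valid.state_mem (hS : S.Valid N) (g : ℕ → Space n) (t : ℕ) : (S.state g t).2 ∈ S.Q := by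
  induction t with
  | zero => exact hS.mirror_mem 0 0
  | succ t ih => exact hS.mix_mem t ih (hS.mirror_mem _ _)

lemma Valid.query_mem (hS : S.Valid N) (g : ℕ → Space n) (t : ℕ) : S.query g t ∈ S.Q :=
  hS.mix_mem t (hS.state_mem g t) (hS.mirror_mem _ _)

/-- The step size condition of accelerated methods. -/
lemma Valid.stepSize_sq_le (hS : S.Valid N) (t : ℕ) :
    2 * S.L * stepSize S.q t ^ 2 ≤ weight S.q (t + 1) * S.modulus t := by
  have hL := hS.L_pos
  have hA := weight_nonneg S.q t
  have hA' := weight_ge S.q (t + 1)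
  have hmono : weight S.q t ≤ weight S.q (t + 1) := monotone_weight _ t.le_succ
  have hμA := mul_nonneg hS.μ_nonneg hA
  push_cast at hA'
  have h1 : 4 * S.L ≤ S.modulus t := by unfold modulus; linarith
  have h2 : S.μ * weight S.q t ≤ S.modulus t := by unfold modulus; linarith
  rcases max_cases ((t : ℝ) + 1) (S.q * weight S.q t) with h | h
  · rw [stepSize, h.1]
    calc 2 * S.L * ((t : ℝ) + 1) ^ 2 ≤ (((t : ℝ) + 1) * (t + 1 + 1) / 2) * (4 * S.L) := by
          have : (0 : ℝ) ≤ t := t.cast_nonneg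
          nlinarith [mul_nonneg hL.le this]
      _ ≤ _ := mul_le_mul hA' h1 (by positivity) (weight_nonneg _ _)
  · rw [stepSize, h.1]
    calc 2 * S.L * (S.q * weight S.q t) ^ 2
          = weight S.q t * (2 * S.L * S.q ^ 2 * weight S.q t) := by ring
      _ ≤ weight S.q t * (S.μ * weight S.q t) :=
          mul_le_mul_of_nonneg_left (mul_le_mul_of_nonneg_right hS.rate hA) hA
      _ ≤ _ := mul_le_mul hmono h2 hμA (weight_nonneg _ _)

lemma Valid.sq_div_modulus_le (hS : S.Valid N) (t : ℕ) :
    stepSize S.q t ^ 2 / S.modulus t ≤ weight S.q (t + 1) / (2 * S.L) := by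
  have := hS.L_pos
  rw [div_le_div_iff₀ (hS.modulus_pos t) (by positivity)]
  linarith [hS.stepSize_sq_le t]

/-- What the method uses about the objective `F` and its gradient `G`: an upper quadratic model and
a lower model, whose curvature is `μ` times that of the prox-function. -/
structure Model (S : Scheme n) (N : Seminorm ℝ (Space n)) (F : Space n → ℝ)
    (G : Space n → Space n) : Prop where
  upper : ∀ x ∈ S.Q, ∀ y ∈ S.Q, F y ≤ F x + inner ℝ (G x) (y - x) + S.L / 2 * N (y - x) ^ 2
  lower : ∀ x ∈ S.Q, ∀ z ∈ S.Q, F x + inner ℝ (G x) (z - x)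
    + S.μ * (S.d z - S.d x - inner ℝ (x - S.x₀) (z - x)) ≤ F z

/-- The potential of the method relative to the comparison point `z`. -/
noncomputable def potential (S : Scheme n) (F : Space n → ℝ) (z : Space n) (g : ℕ → Space n)
    (t : ℕ) : ℝ :=
  weight S.q t * (F (S.state g t).2 - F z)
    + (S.modulus t * S.d z + inner ℝ (S.state g t).1 z
      - proxValue S.Q S.d (S.modulus t) (S.state g t).1)

/-- One iteration with gradient error `e` changes the potential by at most the linear term of the
error at `z` and half the decrease of the prox-value under the perturbation `2 a e`. -/
lemma Valid.potential_succ_le (hS : S.Valid N) {F : Space n → ℝ} {G : Space n → Space n}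
    (hF : S.Model N F G) {z : Space n} (hz : z ∈ S.Q) (g : ℕ → Space n) (t : ℕ) {e : Space n}
    (he : g t = G (S.query g t) + e) :
    S.potential F z g (t + 1) ≤ S.potential F z g t + stepSize S.q t * inner ℝ e z
      - (proxValue S.Q S.d (S.modulus t) ((S.state g t).1 + (2 * stepSize S.q t) • e)
        - proxValue S.Q S.d (S.modulus t) (S.state g t).1) / 2 := by
  have hA0 := weight_nonneg S.q t
  have hA' := weight_succ_pos S.q t
  have ha := stepSize_pos S.q t
  have hβ := hS.modulus_pos t
  have hstep := hS.stepSize_sq_le t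
  have hAs := weight_succ S.q t
  have hβ' : S.modulus (t + 1) = S.modulus t + S.μ * stepSize S.q t := by
    simp only [modulus, weight_succ]; ring
  have hu' := hS.mirror_mem (t + 1) (S.state g (t + 1)).1
  have hy := hS.state_mem g t
  have hx := hS.query_mem g t
  have hy' := hS.state_mem g (t + 1)
  have hpv' : proxValue S.Q S.d (S.modulus (t + 1)) (S.state g (t + 1)).1
      = S.modulus (t + 1) * S.d (S.mirror (t + 1) (S.state g (t + 1)).1)
        + inner ℝ (S.state g (t + 1)).1 (S.mirror (t + 1) (S.state g (t + 1)).1) := rfl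
  have hgrow := proxValue_growth hS.convex hS.isCompact hS.nonempty hS.prox hβ (S.state g t).1 hu'
  have hpert := proxValue_le hS.convex hS.isCompact hS.nonempty hS.prox hβ
    ((S.state g t).1 + (2 * stepSize S.q t) • e) hu'
  have hbr := hS.bregman _ hx _ hu'
  have hup := hF.upper _ hx _ hy'
  have hly := hF.lower _ hx _ hy
  have hlz := hF.lower _ hx _ hz
  have hbry := hS.bregman _ hx _ hy
  have hs' := S.state_succ_fst g t
  have hdiff : weight S.q (t + 1) • ((S.state g (t + 1)).2 - S.query g t)
      = stepSize S.q t • (S.mirror (t + 1) (S.state g (t + 1)).1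
        - S.mirror t (S.state g t).1) := by
    rw [state_succ_snd, query, mix, mix, add_sub_add_left_eq_sub, ← smul_sub, smul_smul,
      mul_div_cancel₀ _ hA'.ne']
  have hbary : weight S.q (t + 1) • S.query g t
      = weight S.q t • (S.state g t).2 + stepSize S.q t • S.mirror t (S.state g t).1 := by
    rw [query, mix, smul_add, smul_smul, smul_smul, mul_div_cancel₀ _ hA'.ne',
      mul_div_cancel₀ _ hA'.ne']
  rw [potential, potential, hpv', hβ']
  change _ + S.modulus t / 2 * N (S.mirror (t + 1) (S.state g (t + 1)).1
    - S.mirror t (S.state g t).1) ^ 2 ≤ _ at hgrow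
  generalize S.mirror (t + 1) (S.state g (t + 1)).1 = u' at *
  generalize S.mirror t (S.state g t).1 = u at *
  generalize S.query g t = x at *
  generalize (S.state g (t + 1)).2 = y' at *
  generalize (S.state g (t + 1)).1 = s' at *
  generalize (S.state g t).2 = y at *
  generalize (S.state g t).1 = s at *
  generalize proxValue S.Q S.d (S.modulus t) (s + (2 * stepSize S.q t) • e) = v₂ at *
  generalize proxValue S.Q S.d (S.modulus t) s = v at *
  generalize S.modulus t = β at *
  generalize stepSize S.q t = a at *
  generalize weight S.q (t + 1) = A' at *
  generalize weight S.q t = A at *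
  subst hs' hAs
  rw [he]
  -- the quadratic term of the upper model is absorbed by the growth of the prox-problem
  have hquad : (A + a) * (S.L / 2 * N (y' - x) ^ 2) ≤ β / 4 * N (u' - u) ^ 2 := by
    have h1 : N ((A + a) • (y' - x)) = N (a • (u' - u)) := by rw [hdiff]
    rw [map_smul_eq_mul, map_smul_eq_mul, Real.norm_of_nonneg hA'.le,
      Real.norm_of_nonneg ha.le] at h1
    refine le_of_mul_le_mul_left ?_ hA'
    calc (A + a) * ((A + a) * (S.L / 2 * N (y' - x) ^ 2))
        = S.L / 2 * ((A + a) * N (y' - x)) ^ 2 := by ring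
      _ = (2 * S.L * a ^ 2) * (N (u' - u) ^ 2 / 4) := by rw [h1]; ring
      _ ≤ ((A + a) * β) * (N (u' - u) ^ 2 / 4) :=
          mul_le_mul_of_nonneg_right hstep (by positivity)
      _ = _ := by ring
  have hd1 := congrArg (fun v => inner ℝ (G x) v) hdiff
  have hd2 := congrArg (fun v => inner ℝ (G x) v) hbary
  simp only [inner_add_left, inner_add_right, inner_sub_left, inner_sub_right, inner_smul_left,
    inner_smul_right, RCLike.conj_to_real] at hd1 hd2 hup hly hlz hbr hbry hpert hgrow ⊢
  have e1 := mul_le_mul_of_nonneg_left hup hA'.le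
  have e2 := mul_le_mul_of_nonneg_left hly hA0
  have e3 := mul_le_mul_of_nonneg_left hlz ha.le
  have e4 := mul_nonneg ha.le hbr
  have e5 := mul_nonneg hA0 hbry
  linarith

/-- Telescoped form: the accuracy at `z` is bounded by the prox-diameter term, a sum of linear
terms in the error coefficients `α t j`, and a sum of their squares. The linear term of `α t j`
involves only earlier errors. -/
theorem Valid.weight_mul_le (hS : S.Valid N) {F : Space n → ℝ} {G : Space n → Space n}
    (hF : S.Model N F G) {z : Space n} (hz : z ∈ S.Q) (g : ℕ → Space n) {w : ℕ → Space n}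
    (hw : ∀ j, w j ∈ dualBall N) (α : ℕ → ℕ → ℝ) (b : ℕ → ℝ) (J : ℕ → ℕ)
    (T : ℕ) (hg : ∀ t < T, g t = G (S.query g t) + (b t)⁻¹ • ∑ j ∈ Finset.range (J t), α t j • w j) :
    weight S.q T * (F (S.state g T).2 - F z) ≤ 4 * S.L * (S.d z - S.d (S.mirror 0 0))
      + ∑ t ∈ Finset.range T, ∑ j ∈ Finset.range (J t),
        (α t j * (stepSize S.q t / b t * inner ℝ (w j) (z - S.mirror t ((S.state g t).1
            + ∑ i ∈ Finset.range j, (2 * stepSize S.q t / b t * α t i) • w i)))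
          + stepSize S.q t ^ 2 / (b t ^ 2 * S.modulus t) * α t j ^ 2) := by
  have hpot : ∀ t ≤ T, S.potential F z g t ≤ 4 * S.L * (S.d z - S.d (S.mirror 0 0))
      + ∑ t ∈ Finset.range t, ∑ j ∈ Finset.range (J t),
        (α t j * (stepSize S.q t / b t * inner ℝ (w j) (z - S.mirror t ((S.state g t).1
            + ∑ i ∈ Finset.range j, (2 * stepSize S.q t / b t * α t i) • w i)))
          + stepSize S.q t ^ 2 / (b t ^ 2 * S.modulus t) * α t j ^ 2) := by
    intro t ht
    induction t with
    | zero =>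
      have : proxValue S.Q S.d (S.modulus 0) 0 = 4 * S.L * S.d (S.mirror 0 0) := by
        rw [proxValue, inner_zero_left, add_zero, mirror, modulus, weight, mul_zero, add_zero]
      have h0 : S.modulus 0 = 4 * S.L := by simp [modulus, weight]
      rw [h0] at this
      simp only [potential, state, h0, this, weight]
      simp
      linarith
    | succ t ih =>
      have h1 := hS.potential_succ_le hF hz g t (hg t ht)
      have h2 := proxValue_add_sum_ge hS.convex hS.isCompact hS.nonempty hS.prox
        (hS.modulus_pos t) (S.state g t).1 hw (fun j => 2 * stepSize S.q t / b t * α t j) (J t)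
      have h3 : (2 * stepSize S.q t) • (b t)⁻¹ • ∑ j ∈ Finset.range (J t), α t j • w j
          = ∑ j ∈ Finset.range (J t), (2 * stepSize S.q t / b t * α t j) • w j := by
        rw [smul_smul, Finset.smul_sum]
        exact Finset.sum_congr rfl fun j _ => by rw [smul_smul, div_eq_mul_inv]
      have h4 : stepSize S.q t * inner ℝ ((b t)⁻¹ • ∑ j ∈ Finset.range (J t), α t j • w j) z
          = ∑ j ∈ Finset.range (J t), α t j * (stepSize S.q t / b t * inner ℝ (w j) z) := by
        rw [inner_smul_left, sum_inner, Finset.mul_sum, Finset.mul_sum]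
        refine Finset.sum_congr rfl fun j _ => ?_
        rw [inner_smul_left, RCLike.conj_to_real, RCLike.conj_to_real, div_eq_mul_inv]
        ring
      rw [h3, h4] at h1
      rw [Finset.sum_range_succ]
      have ih := ih (Nat.le_of_succ_le ht)
      have h5 : ∑ j ∈ Finset.range (J t),
          (α t j * (stepSize S.q t / b t * inner ℝ (w j) (z - S.mirror t ((S.state g t).1
            + ∑ i ∈ Finset.range j, (2 * stepSize S.q t / b t * α t i) • w i)))
          + stepSize S.q t ^ 2 / (b t ^ 2 * S.modulus t) * α t j ^ 2)
          = ∑ j ∈ Finset.range (J t), α t j * (stepSize S.q t / b t * inner ℝ (w j) z)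
            - (∑ j ∈ Finset.range (J t), (2 * stepSize S.q t / b t * α t j *
              inner ℝ (w j) (S.mirror t ((S.state g t).1
                + ∑ i ∈ Finset.range j, (2 * stepSize S.q t / b t * α t i) • w i))
              - (2 * stepSize S.q t / b t * α t j) ^ 2 / (2 * S.modulus t))) / 2 := by
        rw [Finset.sum_div, ← Finset.sum_sub_distrib]
        refine Finset.sum_congr rfl fun j _ => ?_
        rw [inner_sub_right]
        have := (hS.modulus_pos t).ne'
        rcases eq_or_ne (b t) 0 with hb | hb
        · simp [hb]
        · field_simp
          ring
      rw [h5]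
      simp only [mirror]
      simp only [mirror] at h1 ih
      linarith
  have h6 := hpot T le_rfl
  have h7 := proxValue_le hS.convex hS.isCompact hS.nonempty hS.prox (hS.modulus_pos T)
    (S.state g T).1 hz
  rw [potential] at h6
  linarith

end Scheme

lemma sum_range_mul_of_periodic {M : Type*} [AddCommMonoid M] {f : ℕ → M} {m : ℕ}
    (hf : ∀ j, f (j + m) = f j) (b : ℕ) :
    ∑ j ∈ Finset.range (m * b), f j = b • ∑ j ∈ Finset.range m, f j := by
  induction b with
  | zero => simp
  | succ b ih =>
    have h : ∀ c j, f (m * c + j) = f j := by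
      intro c
      induction c with
      | zero => simp
      | succ c ihc => intro j; rw [Nat.mul_succ, add_right_comm, hf, ihc]
    rw [Nat.mul_succ, Finset.sum_range_add, ih, succ_nsmul]
    simp only [h]

/-- The design of `exists_design`, continued periodically. -/
structure IsPeriodicDesign {n : ℕ} (N : Seminorm ℝ (Space n)) (w p : ℕ → Space n) : Prop where
  mem_dualBall : ∀ j, w j ∈ dualBall N
  sum_inner_smul : ∀ (b : ℕ) (g : Space n),
    ∑ j ∈ Finset.range ((n + n) * b), (inner ℝ g (p j) : ℝ) • w j = (b : ℝ) • g
  sum_inner_sq_le : ∀ (b : ℕ) (ζ : Space n),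
    ∑ j ∈ Finset.range ((n + n) * b), (inner ℝ ζ (p j) : ℝ) ^ 2 ≤ b * dualNorm N ζ ^ 2
  sum_norm_sq_le : ∀ b : ℕ, ∑ j ∈ Finset.range ((n + n) * b), ‖p j‖ ^ 2 ≤ b * n

lemma exists_periodicDesign {n : ℕ} (hn : 0 < n) {N : Seminorm ℝ (Space n)}
    (hN : ∀ x, ‖x‖ ≤ N x) : ∃ w p : ℕ → Space n, IsPeriodicDesign N w p := by
  obtain ⟨w, p, h1, h2, h3, h4⟩ := exists_design hN
  have hnn : 0 < n + n := by omega
  set r : ℕ → Fin n ⊕ Fin n := fun j => finSumFinEquiv.symm ⟨j % (n + n), Nat.mod_lt _ hnn⟩ with hr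
  have hsum : ∀ {M : Type} [AddCommMonoid M] (φ : Fin n ⊕ Fin n → M) (b : ℕ),
      ∑ j ∈ Finset.range ((n + n) * b), φ (r j) = b • ∑ j, φ j := by
    intro M _ φ b
    rw [sum_range_mul_of_periodic (fun j => by simp [hr]), Finset.sum_range,
      ← Equiv.sum_comp finSumFinEquiv.symm φ]
    congr 1
    refine Finset.sum_congr rfl fun j _ => ?_
    simp only [hr, Nat.mod_eq_of_lt j.2]
  refine ⟨fun j => w (r j), fun j => p (r j), fun j => h1 _, fun b g => ?_, fun b ζ => ?_,
    fun b => ?_⟩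
  · rw [hsum (fun j => (inner ℝ g (p j) : ℝ) • w j), h2, Nat.cast_smul_eq_nsmul]
  · rw [hsum (fun j => (inner ℝ ζ (p j) : ℝ) ^ 2), nsmul_eq_mul]
    exact mul_le_mul_of_nonneg_left (h3 ζ) b.cast_nonneg
  · rw [hsum (fun j => ‖p j‖ ^ 2), nsmul_eq_mul]
    exact mul_le_mul_of_nonneg_left h4 b.cast_nonneg

/-! ### The method -/

/-- The law of a fair coin. -/
noncomputable def coin : Measure Bool :=
  (2⁻¹ : ENNReal) • (Measure.dirac true + Measure.dirac false)

instance : IsProbabilityMeasure coin := by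
  constructor
  simp [coin, ENNReal.inv_two_add_inv_two]

/-- The sign shown by a coin. -/
def sgn (τ : Bool) : ℝ := if τ then 1 else -1

lemma sgn_mul_self (τ : Bool) : sgn τ * sgn τ = 1 := by cases τ <;> simp [sgn]

lemma abs_sgn (τ : Bool) : |sgn τ| = 1 := by cases τ <;> simp [sgn]

lemma measurable_sgn : Measurable sgn := measurable_of_finite _

lemma integral_sgn : ∫ τ, sgn τ ∂coin = 0 := by
  rw [coin, integral_smul_measure, integral_add_measure (Integrable.of_finite)
    (Integrable.of_finite), integral_dirac, integral_dirac]
  simp [sgn]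

/-- The direction of `p`, or the default direction `e` if `p = 0`. -/
noncomputable def unitDir {n : ℕ} (e p : Space n) : Space n :=
  open Classical in if p = 0 then e else ‖p‖⁻¹ • p

lemma norm_unitDir {n : ℕ} {e : Space n} (he : ‖e‖ = 1) (p : Space n) : ‖unitDir e p‖ = 1 := by
  unfold unitDir
  split_ifs with h
  · exact he
  · rw [norm_smul, norm_inv, norm_norm, inv_mul_cancel₀ (norm_ne_zero_iff.2 h)]

lemma norm_mul_inner_unitDir {n : ℕ} (e p g : Space n) :
    ‖p‖ * inner ℝ g (unitDir e p) = inner ℝ g p := by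
  unfold unitDir
  split_ifs with h
  · simp [h]
  · rw [inner_smul_right, mul_inv_cancel_left₀ (norm_ne_zero_iff.2 h)]

/-- The data of the randomized oracle calls: the design vectors, a default direction, the number of
repetitions of the design in each iteration, and the position of the (single) call made with each
realization. -/
structure Calls (n k : ℕ) where
  w : ℕ → Space n
  p : ℕ → Space n
  e : Space n
  norm_e : ‖e‖ = 1
  batch : ℕ → ℕ
  first : Fin k
  first_eq : (first : ℕ) = 0

namespace Calls

variable {n k : ℕ} (O : Calls n k)

/-- The gradient estimate computed from the answers of iteration `t`: the signs that were put on the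
directions are taken back, so that the noise is multiplied by a random sign. -/
noncomputable def estimate (u : ℕ × ℕ → Bool) (h : Record k) (t : ℕ) : Space n :=
  (O.batch t : ℝ)⁻¹ • ∑ j ∈ Finset.range ((n + n) * O.batch t),
    (sgn (u (t, j)) * ‖O.p j‖ * h t j O.first) • O.w j

lemma measurable_estimate (t : ℕ) :
    Measurable fun q : (ℕ × ℕ → Bool) × Record k => O.estimate q.1 q.2 t := by
  have h1 : ∀ j, Measurable fun q : (ℕ × ℕ → Bool) × Record k => sgn (q.1 (t, j)) := fun j =>
    measurable_sgn.comp ((measurable_pi_apply _).comp measurable_fst)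
  have h2 : ∀ j, Measurable fun q : (ℕ × ℕ → Bool) × Record k => q.2 t j O.first := fun j =>
    (measurable_pi_apply O.first).comp ((measurable_pi_apply j).comp
      ((measurable_pi_apply t).comp measurable_snd))
  unfold estimate
  fun_prop

/-- The error of the coefficient of `w j` in the gradient estimate at `x` (up to the factor
`1 / batch`), for a call with sign `y.1`, realization `y.2.1` and noises `y.2.2`. -/
noncomputable def error {Ξ : Type*} [MeasurableSpace Ξ]
    (P : Measure Ξ) (f : Space n → Ξ → ℝ) (j : ℕ) (x : Space n) (y : Bool × (Ξ × (Fin k → ℝ))) : ℝ :=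
  inner ℝ (stochGrad f x y.2.1 - meanGrad P f x) (O.p j) + sgn y.1 * (‖O.p j‖ * y.2.2 O.first)

end Calls

namespace Scheme

variable {n k : ℕ} {S : Scheme n} {N : Seminorm ℝ (Space n)}

section
variable {Ω : Type*} [MeasurableSpace Ω]

lemma measurable_mix (t : ℕ) {Y U : Ω → Space n} (hY : Measurable Y) (hU : Measurable U) :
    Measurable fun ω => S.mix t (Y ω) (U ω) := by
  unfold mix
  fun_prop

lemma Valid.measurable_state (hS : S.Valid N) {g : Ω → ℕ → Space n} {t : ℕ}
    (hg : ∀ i < t, Measurable fun ω => g ω i) : Measurable fun ω => S.state (g ω) t := by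
  induction t with
  | zero => exact measurable_const
  | succ t ih =>
    have h := ih fun i hi => hg i (hi.trans t.lt_succ_self)
    have hx : Measurable fun ω => S.query (g ω) t :=
      measurable_mix t h.snd ((hS.continuous_mirror t).measurable.comp h.fst)
    have h1 : Measurable fun ω => (S.state (g ω) (t + 1)).1 := by
      have hgt := hg t t.lt_succ_self
      simp only [state_succ_fst]
      fun_prop
    have h2 : Measurable fun ω => (S.state (g ω) (t + 1)).2 := by
      simp only [state_succ_snd]
      exact measurable_mix t h.snd ((hS.continuous_mirror _).measurable.comp h1)
    exact h1.prodMk h2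

lemma Valid.measurable_query (hS : S.Valid N) {g : Ω → ℕ → Space n} {t : ℕ}
    (hg : ∀ i < t, Measurable fun ω => g ω i) : Measurable fun ω => S.query (g ω) t :=
  have h := hS.measurable_state hg
  measurable_mix t h.snd ((hS.continuous_mirror t).measurable.comp h.fst)

end

/-- The method: accelerated dual averaging with `T` iterations, each of which estimates the gradient
by calls along randomly signed design directions, one call per realization. Reducibility lets the
seed type unfold in later statements. -/
@[reducible] noncomputable def Valid.method (hS : S.Valid N) (O : Calls n k) (T : ℕ) : Method n k S.Q where
  Seed := ℕ × ℕ → Bool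
  seedLaw := Measure.infinitePi fun _ => coin
  iterations := T
  realizations t := (n + n) * O.batch t
  calls _ _ := 1
  calls_le _ _ := O.first.pos
  point t u h := S.query (O.estimate u h) t
  direction t j _ u _ := sgn (u (t, j)) • unitDir O.e (O.p j)
  output u h := (S.state (O.estimate u h) T).2
  measurable_point t := hS.measurable_query fun i _ => O.measurable_estimate i
  measurable_direction t j _ := Measurable.smul_const
    (measurable_sgn.comp ((measurable_pi_apply _).comp measurable_fst)) _
  measurable_output := (hS.measurable_state fun i _ => O.measurable_estimate i).snd
  point_mem t u h := hS.query_mem _ t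
  norm_direction t j _ u _ := by
    rw [norm_smul, Real.norm_eq_abs, abs_sgn, norm_unitDir O.norm_e, one_mul]
  output_mem u h := hS.state_mem _ T

end Scheme

lemma Method.record_of_lt {n k : ℕ} {Q : Set (Space n)} {Ξ : Type*} (M : Method n k Q)
    (f : Space n → Ξ → ℝ) (u : M.Seed) (v : ℕ × ℕ → Ξ × (Fin k → ℝ)) {i t : ℕ} (h : i < t) :
    M.record f u v t i = M.record f u v (i + 1) i := by
  induction t with
  | zero => omega
  | succ t ih =>
    rcases Nat.lt_succ_iff_lt_or_eq.1 h with h' | rfl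
    · rw [← ih h']
      funext j l
      exact if_neg fun hc => h'.ne hc.1
    · rfl

namespace Scheme

variable {n k : ℕ} {S : Scheme n} {N : Seminorm ℝ (Space n)} {Ξ : Type*}

/-- The outcomes: the signs and the realizations of all possible oracle calls. -/
abbrev Outcome (Ξ : Type*) (k : ℕ) : Type _ := (ℕ × ℕ → Bool) × (ℕ × ℕ → Ξ × (Fin k → ℝ))

/-- The gradient estimate that the method uses in iteration `t`. The number of iterations, which does
not influence the record (`Valid.record_eq`), is set to `0`. -/
noncomputable def Valid.grad (hS : S.Valid N) (O : Calls n k) (f : Space n → Ξ → ℝ)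
    (ω : Outcome Ξ k) (t : ℕ) : Space n :=
  O.estimate ω.1 ((hS.method O 0).record f ω.1 ω.2 (t + 1)) t

/-- The record does not depend on the number of iterations. -/
lemma Valid.record_eq (hS : S.Valid N) (O : Calls n k) (f : Space n → Ξ → ℝ) (T : ℕ)
    (ω : Outcome Ξ k) (t : ℕ) :
    (hS.method O T).record f ω.1 ω.2 t = (hS.method O 0).record f ω.1 ω.2 t := by
  induction t with
  | zero => rfl
  | succ t ih =>
    funext i j l
    simp only [Method.record, ih]

lemma Valid.estimate_record (hS : S.Valid N) (O : Calls n k) (f : Space n → Ξ → ℝ)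
    (ω : Outcome Ξ k) {i t : ℕ} (h : i < t) :
    O.estimate ω.1 ((hS.method O 0).record f ω.1 ω.2 t) i = hS.grad O f ω i := by
  rw [grad, Calls.estimate, Calls.estimate, Method.record_of_lt _ _ _ _ h]

lemma Valid.result_eq (hS : S.Valid N) (O : Calls n k) (f : Space n → Ξ → ℝ) (T : ℕ)
    (ω : Outcome Ξ k) : (hS.method O T).result f ω = (S.state (hS.grad O f ω) T).2 := by
  change (S.state (O.estimate ω.1 ((hS.method O T).record f ω.1 ω.2 T)) T).2 = _
  rw [hS.record_eq O f T ω T, S.state_congr fun i hi => hS.estimate_record O f ω hi]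

lemma Valid.grad_eq (hS : S.Valid N) (O : Calls n k) (f : Space n → Ξ → ℝ) (ω : Outcome Ξ k)
    (t : ℕ) : hS.grad O f ω t = (O.batch t : ℝ)⁻¹ • ∑ j ∈ Finset.range ((n + n) * O.batch t),
      (inner ℝ (stochGrad f (S.query (hS.grad O f ω) t) (ω.2 (t, j)).1) (O.p j)
        + sgn (ω.1 (t, j)) * (‖O.p j‖ * (ω.2 (t, j)).2 O.first)) • O.w j := by
  rw [grad, Calls.estimate]
  congr 1
  refine Finset.sum_congr rfl fun j hj => ?_
  congr 1
  have hx : (hS.method O 0).point t ω.1 ((hS.method O 0).record f ω.1 ω.2 t)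
      = S.query (hS.grad O f ω) t := S.query_congr fun i hi => hS.estimate_record O f ω hi
  have hrec : (hS.method O 0).record f ω.1 ω.2 (t + 1) t j O.first
      = inner ℝ (stochGrad f ((hS.method O 0).point t ω.1 ((hS.method O 0).record f ω.1 ω.2 t))
          (ω.2 (t, j)).1) (sgn (ω.1 (t, j)) • unitDir O.e (O.p j)) + (ω.2 (t, j)).2 O.first :=
    if_pos ⟨rfl, Finset.mem_range.1 hj, by rw [O.first_eq]; exact one_pos⟩
  rw [hrec, hx, inner_smul_right, ← norm_mul_inner_unitDir O.e (O.p j)]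
  linear_combination ‖O.p j‖ * inner ℝ (stochGrad f (S.query (hS.grad O f ω) t) (ω.2 (t, j)).1)
    (unitDir O.e (O.p j)) * sgn_mul_self (ω.1 (t, j))

end Scheme

/-! ### Resampling one coordinate of a product measure -/

lemma measurePreserving_update {ι X : Type*} [DecidableEq ι] [MeasurableSpace X] (μ : Measure X)
    [IsProbabilityMeasure μ] (i : ι) :
    MeasurePreserving (fun q : (ι → X) × X => Function.update q.1 i q.2)
      ((Measure.infinitePi fun _ : ι => μ).prod μ) (Measure.infinitePi fun _ : ι => μ) := by
  have hm : Measurable fun q : (ι → X) × X => Function.update q.1 i q.2 := by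
    refine measurable_pi_iff.2 fun l => ?_
    rcases eq_or_ne l i with rfl | h
    · simpa using measurable_snd
    · simp only [Function.update_of_ne h]
      exact (measurable_pi_apply l).comp measurable_fst
  refine ⟨hm, Measure.eq_infinitePi _ fun s t ht => ?_⟩
  rw [Measure.map_apply hm (MeasurableSet.pi s.countable_toSet fun l _ => ht l)]
  by_cases hi : i ∈ s
  · have : (fun q : (ι → X) × X => Function.update q.1 i q.2) ⁻¹' (Set.pi s t)
        = (Set.pi (s.erase i) t) ×ˢ t i := by
      ext q
      simp only [Set.mem_preimage, Set.mem_pi, Set.mem_prod, Finset.mem_coe, Finset.mem_erase]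
      constructor
      · intro h
        refine ⟨fun l hl => ?_, ?_⟩
        · simpa [Function.update_of_ne hl.1] using h l hl.2
        · simpa using h i hi
      · rintro ⟨h1, h2⟩ l hl
        rcases eq_or_ne l i with rfl | h
        · simpa using h2
        · simpa [Function.update_of_ne h] using h1 l ⟨h, hl⟩
    rw [this, Measure.prod_prod, Measure.infinitePi_pi _ fun l _ => ht l, mul_comm,
      Finset.mul_prod_erase s (fun l => μ (t l)) hi]
  · have : (fun q : (ι → X) × X => Function.update q.1 i q.2) ⁻¹' (Set.pi s t)
        = (Set.pi s t) ×ˢ Set.univ := by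
      ext q
      simp only [Set.mem_preimage, Set.mem_pi, Set.mem_prod, Finset.mem_coe, Set.mem_univ,
        and_true]
      refine forall₂_congr fun l hl => ?_
      rw [Function.update_of_ne (ne_of_mem_of_not_mem hl hi)]
    rw [this, Measure.prod_prod, Measure.infinitePi_pi _ fun l _ => ht l, measure_univ, mul_one]

lemma measurePreserving_prodProdProdComm {A B C D : Type*} [MeasurableSpace A] [MeasurableSpace B]
    [MeasurableSpace C] [MeasurableSpace D] (a : Measure A) (b : Measure B) (c : Measure C)
    (d : Measure D) [SFinite a] [SFinite b] [SFinite c] [SFinite d] :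
    MeasurePreserving (fun q : (A × B) × (C × D) => ((q.1.1, q.2.1), (q.1.2, q.2.2)))
      ((a.prod b).prod (c.prod d)) ((a.prod c).prod (b.prod d)) := by
  have h1 := measurePreserving_prodAssoc a b (c.prod d)
  have h2 := (measurePreserving_prodAssoc b c d).symm
  have h3 : MeasurePreserving (Prod.map Prod.swap id) ((b.prod c).prod d) ((c.prod b).prod d) :=
    Measure.measurePreserving_swap.prod (MeasurePreserving.id d)
  have h4 := measurePreserving_prodAssoc c b d
  have h5 := (MeasurePreserving.id a).prod (h4.comp (h3.comp h2))
  have h6 := (measurePreserving_prodAssoc a c (b.prod d)).symm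
  exact h6.comp (h5.comp h1)

namespace Scheme

variable {n k : ℕ} {S : Scheme n} {N : Seminorm ℝ (Space n)} {Ξ : Type*}

/-- The outcome in which the sign and the realization with index `i` are replaced by `y`. -/
def resample (i : ℕ × ℕ) (ω : Outcome Ξ k) (y : Bool × (Ξ × (Fin k → ℝ))) : Outcome Ξ k :=
  (Function.update ω.1 i y.1, Function.update ω.2 i y.2)

/-- The joint law of the signs and of the realizations. -/
noncomputable abbrev outcomeLaw [MeasurableSpace Ξ] (ν : Measure (Ξ × (Fin k → ℝ)))
    [IsProbabilityMeasure ν] : Measure (Outcome Ξ k) :=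
  (Measure.infinitePi fun _ : ℕ × ℕ => coin).prod (Measure.infinitePi fun _ : ℕ × ℕ => ν)

lemma measurePreserving_resample [MeasurableSpace Ξ] (ν : Measure (Ξ × (Fin k → ℝ)))
    [IsProbabilityMeasure ν] (i : ℕ × ℕ) :
    MeasurePreserving (fun q : Outcome Ξ k × (Bool × (Ξ × (Fin k → ℝ))) => resample i q.1 q.2)
      ((outcomeLaw ν).prod (coin.prod ν)) (outcomeLaw ν) :=
  ((measurePreserving_update coin i).prod (measurePreserving_update ν i)).comp
    (measurePreserving_prodProdProdComm _ _ _ _)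

/-! ### The error coefficients -/

/-- The gradient estimates depend only on the oracle calls made so far. -/
lemma Valid.grad_congr (hS : S.Valid N) (O : Calls n k) (f : Space n → Ξ → ℝ)
    {ω ω' : Outcome Ξ k} {t : ℕ}
    (h : ∀ i < t, ∀ j, ω.1 (i, j) = ω'.1 (i, j) ∧ ω.2 (i, j) = ω'.2 (i, j)) :
    ∀ i < t, hS.grad O f ω i = hS.grad O f ω' i := by
  intro i
  induction i using Nat.strong_induction_on with
  | _ i ih =>
    intro hi
    rw [hS.grad_eq, hS.grad_eq, S.query_congr fun l hl => ih l hl (hl.trans hi)]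
    congr 1
    refine Finset.sum_congr rfl fun j _ => ?_
    rw [(h i hi j).1, (h i hi j).2]

lemma Valid.grad_resample (hS : S.Valid N) (O : Calls n k) (f : Space n → Ξ → ℝ)
    (ω : Outcome Ξ k) (t j : ℕ) (y : Bool × (Ξ × (Fin k → ℝ))) :
    ∀ i < t, hS.grad O f (resample (t, j) ω y) i = hS.grad O f ω i := by
  refine hS.grad_congr O f fun i hi l => ?_
  have : (i, l) ≠ (t, j) := fun h => hi.ne (congrArg Prod.fst h)
  exact ⟨Function.update_of_ne this _ _, Function.update_of_ne this _ _⟩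

variable [MeasurableSpace Ξ]

/-- The error of the coefficient of the `j`-th call of iteration `t`. -/
noncomputable def Valid.err (hS : S.Valid N) (O : Calls n k) (P : Measure Ξ) (f : Space n → Ξ → ℝ)
    (t j : ℕ) (ω : Outcome Ξ k) : ℝ :=
  O.error P f j (S.query (hS.grad O f ω) t) (ω.1 (t, j), ω.2 (t, j))

lemma Valid.err_resample_self (hS : S.Valid N) (O : Calls n k) (P : Measure Ξ)
    (f : Space n → Ξ → ℝ) (t j : ℕ) (ω : Outcome Ξ k) (y : Bool × (Ξ × (Fin k → ℝ))) :
    hS.err O P f t j (resample (t, j) ω y) = O.error P f j (S.query (hS.grad O f ω) t) y := by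
  rw [err, S.query_congr (hS.grad_resample O f ω t j y)]
  simp [resample]

lemma Valid.err_resample_of_ne (hS : S.Valid N) (O : Calls n k) (P : Measure Ξ)
    (f : Space n → Ξ → ℝ) (t : ℕ) {i j : ℕ} (hij : i ≠ j) (ω : Outcome Ξ k)
    (y : Bool × (Ξ × (Fin k → ℝ))) :
    hS.err O P f t i (resample (t, j) ω y) = hS.err O P f t i ω := by
  have : (t, i) ≠ (t, j) := fun h => hij (congrArg Prod.snd h)
  rw [err, S.query_congr (hS.grad_resample O f ω t j y), err]
  simp [resample, Function.update_of_ne this]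

/-- The gradient estimate is the mean gradient plus the errors along the design. -/
lemma Valid.grad_eq_add (hS : S.Valid N) (O : Calls n k) (hO : IsPeriodicDesign N O.w O.p)
    (P : Measure Ξ) (f : Space n → Ξ → ℝ) (ω : Outcome Ξ k) {t : ℕ} (hb : 0 < O.batch t) :
    hS.grad O f ω t = meanGrad P f (S.query (hS.grad O f ω) t)
      + (O.batch t : ℝ)⁻¹ • ∑ j ∈ Finset.range ((n + n) * O.batch t),
        hS.err O P f t j ω • O.w j := by
  have h := hO.sum_inner_smul (O.batch t) (meanGrad P f (S.query (hS.grad O f ω) t))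
  have hb' : (O.batch t : ℝ) ≠ 0 := by positivity
  have h2 : meanGrad P f (S.query (hS.grad O f ω) t) = (O.batch t : ℝ)⁻¹ •
      ∑ j ∈ Finset.range ((n + n) * O.batch t),
        (inner ℝ (meanGrad P f (S.query (hS.grad O f ω) t)) (O.p j) : ℝ) • O.w j := by
    rw [h, inv_smul_smul₀ hb']
  conv_rhs => rw [h2]
  rw [hS.grad_eq, ← smul_add, ← Finset.sum_add_distrib]
  congr 1
  refine Finset.sum_congr rfl fun j _ => ?_
  rw [← add_smul, err, Calls.error, inner_sub_left]
  congr 1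
  ring

/-- The coefficient of the `j`-th error of iteration `t` in the bound for the potential. -/
noncomputable def Valid.coeff (hS : S.Valid N) (O : Calls n k) (P : Measure Ξ)
    (f : Space n → Ξ → ℝ) (z : Space n) (t j : ℕ) (ω : Outcome Ξ k) : ℝ :=
  stepSize S.q t / O.batch t * inner ℝ (O.w j) (z - S.mirror t ((S.state (hS.grad O f ω) t).1
    + ∑ i ∈ Finset.range j, (2 * stepSize S.q t / O.batch t * hS.err O P f t i ω) • O.w i))

lemma Valid.coeff_resample (hS : S.Valid N) (O : Calls n k) (P : Measure Ξ)
    (f : Space n → Ξ → ℝ) (z : Space n) (t j : ℕ)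
    (ω : Outcome Ξ k) (y : Bool × (Ξ × (Fin k → ℝ))) :
    hS.coeff O P f z t j (resample (t, j) ω y) = hS.coeff O P f z t j ω := by
  rw [coeff, coeff, S.state_congr (hS.grad_resample O f ω t j y)]
  congr 5
  refine Finset.sum_congr rfl fun i hi => ?_
  rw [hS.err_resample_of_ne O P f t (Finset.mem_range.1 hi).ne]

lemma Valid.exists_abs_coeff_le (hS : S.Valid N) (O : Calls n k) (hO : IsPeriodicDesign N O.w O.p)
    (P : Measure Ξ) (f : Space n → Ξ → ℝ) (z : Space n) (t j : ℕ) :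
    ∃ K : ℝ, ∀ ω : Outcome Ξ k, |hS.coeff O P f z t j ω| ≤ K := by
  have hc : ContinuousOn (fun v => N (z - v)) S.Q := by
    have := continuous_seminorm N
    fun_prop
  obtain ⟨K, hK⟩ := hS.isCompact.exists_bound_of_continuousOn hc
  refine ⟨|stepSize S.q t / O.batch t| * K, fun ω => ?_⟩
  rw [coeff, abs_mul]
  refine mul_le_mul_of_nonneg_left ?_ (abs_nonneg _)
  refine (abs_inner_le_of_mem_dualBall (hO.mem_dualBall j) _).trans ?_
  exact (le_abs_self _).trans (hK _ (hS.mirror_mem _ _))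

section Moments

variable {L D δ : ℝ} {P : Measure Ξ} {f : Space n → Ξ → ℝ} {ν : Measure (Ξ × (Fin k → ℝ))}

lemma Valid.measurable_grad [IsProbabilityMeasure P] (hS : S.Valid N) (O : Calls n k)
    (hf : IsSmoothStochastic N S.Q S.L D P f) (t : ℕ) :
    Measurable fun ω : Outcome Ξ k => hS.grad O f ω t := by
  induction t using Nat.strong_induction_on with
  | _ t ih =>
    have hx := hS.measurable_query ih
    have h1 : ∀ j, Measurable fun ω : Outcome Ξ k => sgn (ω.1 (t, j)) := fun j =>
      measurable_sgn.comp ((measurable_pi_apply _).comp measurable_fst)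
    have h2 : ∀ j, Measurable fun ω : Outcome Ξ k => ω.2 (t, j) := fun j =>
      (measurable_pi_apply _).comp measurable_snd
    have h3 : ∀ j, Measurable fun ω : Outcome Ξ k => (ω.2 (t, j)).2 O.first := fun j =>
      (measurable_pi_apply _).comp (h2 j).snd
    have h4 : ∀ j, Measurable fun ω : Outcome Ξ k =>
        stochGrad f (S.query (hS.grad O f ω) t) (ω.2 (t, j)).1 := fun j =>
      hf.measurable_stochGrad_comp hS.le_norm hS.L_pos hx (fun ω => hS.query_mem _ t) (h2 j).fst
    simp only [hS.grad_eq O f _ t]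
    fun_prop

lemma measurable_error_comp [IsProbabilityMeasure P] (hS : S.Valid N) (O : Calls n k)
    (hf : IsSmoothStochastic N S.Q S.L D P f) {Ω : Type*} [MeasurableSpace Ω] (j : ℕ)
    {X : Ω → Space n} {Y : Ω → Bool × (Ξ × (Fin k → ℝ))} (hX : Measurable X)
    (hXQ : ∀ ω, X ω ∈ S.Q) (hY : Measurable Y) :
    Measurable fun ω => O.error P f j (X ω) (Y ω) := by
  have h1 : Measurable fun ω => sgn (Y ω).1 := measurable_sgn.comp hY.fst
  have h2 : Measurable fun ω => (Y ω).2.2 O.first := (measurable_pi_apply _).comp hY.snd.snd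
  have h3 := hf.measurable_stochGrad_comp hS.le_norm hS.L_pos hX hXQ hY.snd.fst
  have h4 := hf.measurable_meanGrad_comp hS.le_norm hS.L_pos hX hXQ
  unfold Calls.error
  fun_prop

lemma Valid.measurable_err [IsProbabilityMeasure P] (hS : S.Valid N) (O : Calls n k)
    (hf : IsSmoothStochastic N S.Q S.L D P f) (t j : ℕ) :
    Measurable (hS.err O P f t j) :=
  measurable_error_comp hS O hf j (hS.measurable_query fun i _ => hS.measurable_grad O hf i)
    (fun _ => hS.query_mem _ t) (((measurable_pi_apply _).comp measurable_fst).prodMk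
      ((measurable_pi_apply _).comp measurable_snd))

lemma integral_error_eq_zero [IsProbabilityMeasure P] [IsProbabilityMeasure ν]
    (O : Calls n k) (hf : IsSmoothStochastic N S.Q L D P f)
    (hν : IsOracleLaw k P δ ν) (j : ℕ) {x : Space n} (hx : x ∈ S.Q) :
    ∫ y, O.error P f j x y ∂(coin.prod ν) = 0 := by
  have hi1 : Integrable (fun ξ => inner ℝ (stochGrad f x ξ - meanGrad P f x) (O.p j)) P :=
    ((hf.integrable_grad x hx).sub (integrable_const _)).inner_const _
  have hz1 : ∫ ξ, inner ℝ (stochGrad f x ξ - meanGrad P f x) (O.p j) ∂P = 0 := by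
    simp only [inner_sub_left]
    rw [integral_sub ((hf.integrable_grad x hx).inner_const _) (integrable_const _),
      hf.integral_inner_stochGrad hx]
    simp
  have hfst : MeasurePreserving (Prod.fst : Ξ × (Fin k → ℝ) → Ξ) ν P :=
    ⟨measurable_fst, hν.map_fst⟩
  have hproj : MeasurePreserving (fun y : Bool × (Ξ × (Fin k → ℝ)) => y.2.1) (coin.prod ν) P :=
    hfst.comp measurePreserving_snd
  have hI1 : Integrable (fun y : Bool × (Ξ × (Fin k → ℝ)) =>
      inner ℝ (stochGrad f x y.2.1 - meanGrad P f x) (O.p j)) (coin.prod ν) :=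
    hproj.integrable_comp_of_integrable hi1
  have hZ1 : ∫ y, inner ℝ (stochGrad f x y.2.1 - meanGrad P f x) (O.p j) ∂(coin.prod ν) = 0 := by
    rw [← hz1, ← hproj.map_eq, integral_map hproj.measurable.aemeasurable]
    rw [hproj.map_eq]
    exact hi1.aestronglyMeasurable
  have hi2 : Integrable (fun v : Ξ × (Fin k → ℝ) => ‖O.p j‖ * v.2 O.first) ν := by
    refine Integrable.const_mul (Integrable.of_bound
      ((measurable_pi_apply O.first).comp measurable_snd).aestronglyMeasurable δ ?_) _
    filter_upwards [hν.noise_le] with v hv using hv O.first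
  have hI2 : Integrable (fun y : Bool × (Ξ × (Fin k → ℝ)) =>
      sgn y.1 * (‖O.p j‖ * y.2.2 O.first)) (coin.prod ν) :=
    Integrable.mul_prod (Integrable.of_finite (f := sgn)) hi2
  unfold Calls.error
  rw [integral_add hI1 hI2, hZ1, zero_add,
    integral_prod_mul sgn (fun v : Ξ × (Fin k → ℝ) => ‖O.p j‖ * v.2 O.first), integral_sgn,
    zero_mul]

lemma lintegral_sum_error_sq_le [IsProbabilityMeasure P] [IsProbabilityMeasure ν]
    (O : Calls n k) (hO : IsPeriodicDesign N O.w O.p)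
    (hf : IsSmoothStochastic N S.Q S.L D P f) (hν : IsOracleLaw k P δ ν) (b : ℕ) {x : Space n}
    (hx : x ∈ S.Q) :
    ∫⁻ y, ∑ j ∈ Finset.range ((n + n) * b), ENNReal.ofReal (O.error P f j x y ^ 2) ∂(coin.prod ν)
      ≤ ENNReal.ofReal (2 * b) * ENNReal.ofReal D + ENNReal.ofReal (2 * b * (n * δ ^ 2)) := by
  have hfst : MeasurePreserving (Prod.fst : Ξ × (Fin k → ℝ) → Ξ) ν P :=
    ⟨measurable_fst, hν.map_fst⟩
  have hproj : MeasurePreserving (fun y : Bool × (Ξ × (Fin k → ℝ)) => y.2.1) (coin.prod ν) P :=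
    hfst.comp measurePreserving_snd
  set φ : Ξ → ENNReal := fun ξ => ENNReal.ofReal (2 * ∑ j ∈ Finset.range ((n + n) * b),
    (inner ℝ (stochGrad f x ξ - meanGrad P f x) (O.p j) : ℝ) ^ 2) with hφ
  have hφm : Measurable φ := by
    have := hf.measurable_grad x hx
    refine ENNReal.measurable_ofReal.comp ?_
    fun_prop
  have hae : ∀ᵐ y ∂(coin.prod ν), |y.2.2 O.first| ≤ δ := by
    have := Measure.quasiMeasurePreserving_snd (μ := coin) (ν := ν) |>.ae hν.noise_le
    filter_upwards [this] with y hy using hy O.first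
  have hpt : ∀ᵐ y ∂(coin.prod ν), ∑ j ∈ Finset.range ((n + n) * b),
      ENNReal.ofReal (O.error P f j x y ^ 2)
        ≤ φ y.2.1 + ENNReal.ofReal (2 * b * (n * δ ^ 2)) := by
    filter_upwards [hae] with y hy
    rw [← ENNReal.ofReal_sum_of_nonneg fun j _ => sq_nonneg _, hφ,
      ← ENNReal.ofReal_add (by positivity) (by positivity)]
    refine ENNReal.ofReal_le_ofReal ?_
    have h1 : ∀ j, O.error P f j x y ^ 2
        ≤ 2 * (inner ℝ (stochGrad f x y.2.1 - meanGrad P f x) (O.p j) : ℝ) ^ 2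
          + 2 * δ ^ 2 * ‖O.p j‖ ^ 2 := by
      intro j
      have h2 : (sgn y.1 * (‖O.p j‖ * y.2.2 O.first)) ^ 2 ≤ δ ^ 2 * ‖O.p j‖ ^ 2 := by
        have h3 : y.2.2 O.first ^ 2 ≤ δ ^ 2 := sq_le_sq' (neg_le_of_abs_le hy) (le_of_abs_le hy)
        rw [mul_pow, sq (sgn y.1), sgn_mul_self, one_mul, mul_pow, mul_comm]
        exact mul_le_mul_of_nonneg_right h3 (by positivity)
      unfold Calls.error
      linarith [add_sq_le (a := (inner ℝ (stochGrad f x y.2.1 - meanGrad P f x) (O.p j) : ℝ))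
        (b := sgn y.1 * (‖O.p j‖ * y.2.2 O.first))]
    refine (Finset.sum_le_sum fun j _ => h1 j).trans ?_
    rw [Finset.sum_add_distrib, ← Finset.mul_sum, ← Finset.mul_sum]
    have := mul_le_mul_of_nonneg_left (hO.sum_norm_sq_le b) (by positivity : 0 ≤ 2 * δ ^ 2)
    linarith
  calc _ ≤ ∫⁻ y, (φ y.2.1 + ENNReal.ofReal (2 * b * (n * δ ^ 2))) ∂(coin.prod ν) :=
        lintegral_mono_ae hpt
    _ = ∫⁻ ξ, φ ξ ∂P + ENNReal.ofReal (2 * b * (n * δ ^ 2)) := by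
        rw [lintegral_add_right _ measurable_const, hproj.lintegral_comp hφm, lintegral_const,
          measure_univ, mul_one]
    _ ≤ _ := by
        gcongr
        calc ∫⁻ ξ, φ ξ ∂P ≤ ∫⁻ ξ, ENNReal.ofReal (2 * b)
              * ENNReal.ofReal (dualNorm N (stochGrad f x ξ - meanGrad P f x) ^ 2) ∂P := by
              refine lintegral_mono fun ξ => ?_
              rw [← ENNReal.ofReal_mul (by positivity)]
              refine ENNReal.ofReal_le_ofReal ?_
              have := hO.sum_inner_sq_le b (stochGrad f x ξ - meanGrad P f x)
              linarith
          _ = ENNReal.ofReal (2 * b) * ∫⁻ ξ,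
              ENNReal.ofReal (dualNorm N (stochGrad f x ξ - meanGrad P f x) ^ 2) ∂P :=
              lintegral_const_mul' _ _ ENNReal.ofReal_ne_top
          _ ≤ _ := by gcongr; exact hf.variance_le x hx

end Moments

end Scheme

namespace Scheme

/-! ### The expected accuracy of the method -/

variable {n k : ℕ} {S : Scheme n} {N : Seminorm ℝ (Space n)} {Ξ : Type*} [MeasurableSpace Ξ]
  {D δ : ℝ} {P : Measure Ξ} {f : Space n → Ξ → ℝ} {ν : Measure (Ξ × (Fin k → ℝ))}
  [IsProbabilityMeasure P] [IsProbabilityMeasure ν]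

lemma Valid.measurable_error_uncurry (hS : S.Valid N) (O : Calls n k)
    (hf : IsSmoothStochastic N S.Q S.L D P f) (t j : ℕ) :
    Measurable fun q : Outcome Ξ k × (Bool × (Ξ × (Fin k → ℝ))) =>
      O.error P f j (S.query (hS.grad O f q.1) t) q.2 :=
  measurable_error_comp hS O hf j
    ((hS.measurable_query fun i _ => hS.measurable_grad O hf i).comp measurable_fst)
    (fun _ => hS.query_mem _ t) measurable_snd

lemma Valid.sum_lintegral_err_sq_le (hS : S.Valid N) (O : Calls n k)
    (hO : IsPeriodicDesign N O.w O.p) (hf : IsSmoothStochastic N S.Q S.L D P f)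
    (hν : IsOracleLaw k P δ ν) (t b : ℕ) :
    ∑ j ∈ Finset.range ((n + n) * b),
        ∫⁻ ω, ENNReal.ofReal (hS.err O P f t j ω ^ 2) ∂(outcomeLaw ν)
      ≤ ENNReal.ofReal (2 * b) * ENNReal.ofReal D + ENNReal.ofReal (2 * b * (n * δ ^ 2)) := by
  have hm : ∀ j, Measurable fun q : Outcome Ξ k × (Bool × (Ξ × (Fin k → ℝ))) =>
      ENNReal.ofReal (O.error P f j (S.query (hS.grad O f q.1) t) q.2 ^ 2) := fun j =>
    ENNReal.measurable_ofReal.comp ((hS.measurable_error_uncurry O hf t j).pow_const 2)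
  have h1 : ∀ j, ∫⁻ ω, ENNReal.ofReal (hS.err O P f t j ω ^ 2) ∂(outcomeLaw ν)
      = ∫⁻ ω, ∫⁻ y, ENNReal.ofReal (O.error P f j (S.query (hS.grad O f ω) t) y ^ 2)
        ∂(coin.prod ν) ∂(outcomeLaw ν) := by
    intro j
    have hm' : Measurable fun ω => ENNReal.ofReal (hS.err O P f t j ω ^ 2) :=
      ENNReal.measurable_ofReal.comp ((hS.measurable_err O hf t j).pow_const 2)
    rw [← (measurePreserving_resample ν (t, j)).lintegral_comp hm']
    simp only [hS.err_resample_self]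
    exact lintegral_prod _ (hm j).aemeasurable
  have hΨ : ∀ j, Measurable fun ω : Outcome Ξ k =>
      ∫⁻ y, ENNReal.ofReal (O.error P f j (S.query (hS.grad O f ω) t) y ^ 2) ∂(coin.prod ν) :=
    fun j => (hm j).lintegral_prod_right'
  have h2 : ∀ ω : Outcome Ξ k, ∑ j ∈ Finset.range ((n + n) * b),
      ∫⁻ y, ENNReal.ofReal (O.error P f j (S.query (hS.grad O f ω) t) y ^ 2) ∂(coin.prod ν)
        ≤ ENNReal.ofReal (2 * b) * ENNReal.ofReal D + ENNReal.ofReal (2 * b * (n * δ ^ 2)) := by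
    intro ω
    have hx := hS.query_mem (hS.grad O f ω) t
    generalize S.query (hS.grad O f ω) t = x at hx ⊢
    have hm' : ∀ j, Measurable fun y : Bool × (Ξ × (Fin k → ℝ)) =>
        ENNReal.ofReal (O.error P f j x y ^ 2) := fun j =>
      ENNReal.measurable_ofReal.comp ((measurable_error_comp hS O hf j
        (measurable_const (a := x)) (fun _ => hx) measurable_id).pow_const 2)
    rw [← lintegral_finsetSum _ fun j _ => hm' j]
    exact lintegral_sum_error_sq_le O hO hf hν b hx
  rw [Finset.sum_congr rfl fun j _ => h1 j, ← lintegral_finsetSum _ fun j _ => hΨ j]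
  generalize ENNReal.ofReal (2 * b) * ENNReal.ofReal D + ENNReal.ofReal (2 * b * (n * δ ^ 2)) = c
    at h2 ⊢
  have hc : ∫⁻ _ω : Outcome Ξ k, c ∂(outcomeLaw ν) = c := by
    rw [lintegral_const, measure_univ, mul_one]
  exact (lintegral_mono h2).trans_eq hc

lemma Valid.integrable_err_sq (hS : S.Valid N) (O : Calls n k)
    (hO : IsPeriodicDesign N O.w O.p) (hf : IsSmoothStochastic N S.Q S.L D P f)
    (hν : IsOracleLaw k P δ ν) (t : ℕ) {b j : ℕ} (hj : j < (n + n) * b) :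
    Integrable (fun ω => hS.err O P f t j ω ^ 2) (outcomeLaw ν) := by
  refine ⟨((hS.measurable_err O hf t j).pow_const 2).aestronglyMeasurable, ?_⟩
  rw [hasFiniteIntegral_iff_ofReal (Filter.Eventually.of_forall fun ω => sq_nonneg _)]
  refine (Finset.single_le_sum (f := fun j => ∫⁻ ω, ENNReal.ofReal (hS.err O P f t j ω ^ 2)
    ∂(outcomeLaw ν)) (fun _ _ => zero_le) (Finset.mem_range.2 hj)).trans_lt
    ((hS.sum_lintegral_err_sq_le O hO hf hν t b).trans_lt ?_)
  exact ENNReal.add_lt_top.2 ⟨ENNReal.mul_lt_top ENNReal.ofReal_lt_top ENNReal.ofReal_lt_top,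
    ENNReal.ofReal_lt_top⟩

lemma Valid.sum_integral_err_sq_le (hS : S.Valid N) (O : Calls n k)
    (hO : IsPeriodicDesign N O.w O.p) (hf : IsSmoothStochastic N S.Q S.L D P f) (hD : 0 ≤ D)
    (hν : IsOracleLaw k P δ ν) (t b : ℕ) :
    ∑ j ∈ Finset.range ((n + n) * b), ∫ ω, hS.err O P f t j ω ^ 2 ∂(outcomeLaw ν)
      ≤ 2 * b * (D + n * δ ^ 2) := by
  have h := hS.sum_lintegral_err_sq_le O hO hf hν t b
  rw [← ENNReal.ofReal_mul (by positivity), ← ENNReal.ofReal_add (by positivity) (by positivity),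
    ← mul_add] at h
  rw [← ENNReal.ofReal_le_ofReal_iff (by positivity)]
  rw [ENNReal.ofReal_sum_of_nonneg fun j _ => integral_nonneg fun ω => sq_nonneg _]
  refine le_trans (Finset.sum_le_sum fun j hj => ?_) h
  rw [ofReal_integral_eq_lintegral_ofReal
    (hS.integrable_err_sq O hO hf hν t (Finset.mem_range.1 hj))
    (Filter.Eventually.of_forall fun ω => sq_nonneg _)]

lemma Valid.integrable_err (hS : S.Valid N) (O : Calls n k)
    (hO : IsPeriodicDesign N O.w O.p) (hf : IsSmoothStochastic N S.Q S.L D P f)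
    (hν : IsOracleLaw k P δ ν) (t : ℕ) {b j : ℕ} (hj : j < (n + n) * b) :
    Integrable (hS.err O P f t j) (outcomeLaw ν) :=
  ((memLp_two_iff_integrable_sq (hS.measurable_err O hf t j).aestronglyMeasurable).2
    (hS.integrable_err_sq O hO hf hν t hj)).integrable one_le_two

/-- An error coefficient is orthogonal to every bounded function of the other oracle calls of the
same iteration and of the earlier iterations. -/
lemma Valid.integral_err_mul_eq_zero (hS : S.Valid N) (O : Calls n k)
    (hO : IsPeriodicDesign N O.w O.p) (hf : IsSmoothStochastic N S.Q S.L D P f)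
    (hν : IsOracleLaw k P δ ν) (t : ℕ) {b j : ℕ} (hj : j < (n + n) * b)
    {φ : Outcome Ξ k → ℝ} (hφ : Measurable φ) {K : ℝ} (hK : ∀ ω, |φ ω| ≤ K)
    (hind : ∀ ω y, φ (resample (t, j) ω y) = φ ω) :
    Integrable (fun ω => hS.err O P f t j ω * φ ω) (outcomeLaw ν) ∧
      ∫ ω, hS.err O P f t j ω * φ ω ∂(outcomeLaw ν) = 0 := by
  have hi : Integrable (fun ω => hS.err O P f t j ω * φ ω) (outcomeLaw ν) :=
    (hS.integrable_err O hO hf hν t hj).mul_bdd hφ.aestronglyMeasurable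
      (Filter.Eventually.of_forall hK)
  refine ⟨hi, ?_⟩
  have hmp := measurePreserving_resample (k := k) ν (t, j)
  have hi' : Integrable (fun q : Outcome Ξ k × (Bool × (Ξ × (Fin k → ℝ))) =>
      hS.err O P f t j (resample (t, j) q.1 q.2) * φ (resample (t, j) q.1 q.2))
      ((outcomeLaw ν).prod (coin.prod ν)) := hmp.integrable_comp_of_integrable hi
  rw [← hmp.map_eq, integral_map hmp.measurable.aemeasurable
    (by rw [hmp.map_eq]; exact hi.aestronglyMeasurable), integral_prod _ hi']
  simp only [hS.err_resample_self, hind]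
  simp only [integral_mul_const, integral_error_eq_zero O hf hν j (hS.query_mem _ t), zero_mul,
    integral_zero]

lemma Valid.measurable_coeff (hS : S.Valid N) (O : Calls n k)
    (hf : IsSmoothStochastic N S.Q S.L D P f) (z : Space n) (t j : ℕ) :
    Measurable (hS.coeff O P f z t j) := by
  have h1 := hS.measurable_state (t := t) fun i _ => hS.measurable_grad O hf i
  have h2 : ∀ i, Measurable (hS.err O P f t i) := fun i => hS.measurable_err O hf t i
  have h3 := (hS.continuous_mirror t).measurable
  have h4 : Measurable fun ω : Outcome Ξ k => (S.state (hS.grad O f ω) t).1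
    + ∑ i ∈ Finset.range j, (2 * stepSize S.q t / O.batch t * hS.err O P f t i ω) • O.w i := by
    have := h1.fst
    fun_prop
  have h5 := h3.comp h4
  unfold coeff
  exact (measurable_const.inner (measurable_const.sub h5)).const_mul _

lemma Valid.integrable_result (hS : S.Valid N) (O : Calls n k)
    (hf : IsSmoothStochastic N S.Q S.L D P f) (T : ℕ) :
    Integrable (fun ω => objective P f ((hS.method O T).result f ω))
      ((hS.method O T).law ν) := by
  change Integrable _ (outcomeLaw ν)
  simp only [hS.result_eq]
  exact hf.integrable_objective_comp hS.le_norm hS.convex hS.isCompact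
    (hS.measurable_state fun i _ => hS.measurable_grad O hf i).snd fun ω => hS.state_mem _ T

/-- The expected accuracy of the method: the linear terms of the potential bound have mean zero,
and the quadratic terms are controlled by the variance and the noise level. -/
theorem Valid.expected_accuracy (hS : S.Valid N) (O : Calls n k)
    (hO : IsPeriodicDesign N O.w O.p) (hf : IsSmoothStochastic N S.Q S.L D P f) (hD : 0 ≤ D)
    (hF : S.Model N (objective P f) (meanGrad P f)) (hν : IsOracleLaw k P δ ν) {R : ℝ}
    (hR : ProxDiameterLE S.Q S.d R) {T : ℕ} (hb : ∀ t < T, 0 < O.batch t) {z : Space n}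
    (hz : z ∈ S.Q) :
    weight S.q T * ((∫ ω, objective P f ((hS.method O T).result f ω) ∂((hS.method O T).law ν))
        - objective P f z)
      ≤ 4 * S.L * R ^ 2 + (D + n * δ ^ 2) / S.L
        * ∑ t ∈ Finset.range T, weight S.q (t + 1) / O.batch t := by
  change weight S.q T * ((∫ ω, objective P f ((hS.method O T).result f ω) ∂(outcomeLaw ν)) - _) ≤ _
  have hres : Integrable (fun ω => objective P f ((hS.method O T).result f ω)) (outcomeLaw ν) :=
    hS.integrable_result O hf T
  have hpt : ∀ ω, weight S.q T * (objective P f ((hS.method O T).result f ω) - objective P f z)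
      ≤ 4 * S.L * (S.d z - S.d (S.mirror 0 0))
      + ∑ t ∈ Finset.range T, ∑ j ∈ Finset.range ((n + n) * O.batch t),
        (hS.err O P f t j ω * hS.coeff O P f z t j ω
          + stepSize S.q t ^ 2 / ((O.batch t : ℝ) ^ 2 * S.modulus t)
            * hS.err O P f t j ω ^ 2) := by
    intro ω
    rw [hS.result_eq]
    exact hS.weight_mul_le hF hz (hS.grad O f ω) hO.mem_dualBall (fun t j => hS.err O P f t j ω)
      (fun t => (O.batch t : ℝ)) (fun t => (n + n) * O.batch t) T
      fun t ht => hS.grad_eq_add O hO P f ω (hb t ht)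
  have hlin : ∀ t, ∀ j ∈ Finset.range ((n + n) * O.batch t),
      Integrable (fun ω => hS.err O P f t j ω * hS.coeff O P f z t j ω) (outcomeLaw ν) ∧
      ∫ ω, hS.err O P f t j ω * hS.coeff O P f z t j ω ∂(outcomeLaw ν) = 0 := by
    intro t j hj
    obtain ⟨K, hK⟩ := hS.exists_abs_coeff_le O hO P f z t j
    exact hS.integral_err_mul_eq_zero O hO hf hν t (Finset.mem_range.1 hj)
      (hS.measurable_coeff O hf z t j) hK (hS.coeff_resample O P f z t j)
  have hquad : ∀ t, ∀ j ∈ Finset.range ((n + n) * O.batch t),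
      Integrable (fun ω => stepSize S.q t ^ 2 / ((O.batch t : ℝ) ^ 2 * S.modulus t)
            * hS.err O P f t j ω ^ 2) (outcomeLaw ν) := fun t j hj =>
    (hS.integrable_err_sq O hO hf hν t (Finset.mem_range.1 hj)).const_mul _
  have hterm : ∀ t, ∀ j ∈ Finset.range ((n + n) * O.batch t),
      Integrable (fun ω => hS.err O P f t j ω * hS.coeff O P f z t j ω
        + stepSize S.q t ^ 2 / ((O.batch t : ℝ) ^ 2 * S.modulus t)
            * hS.err O P f t j ω ^ 2) (outcomeLaw ν) := fun t j hj =>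
    (hlin t j hj).1.add (hquad t j hj)
  have hsum : Integrable (fun ω => ∑ t ∈ Finset.range T,
      ∑ j ∈ Finset.range ((n + n) * O.batch t),
        (hS.err O P f t j ω * hS.coeff O P f z t j ω
          + stepSize S.q t ^ 2 / ((O.batch t : ℝ) ^ 2 * S.modulus t)
            * hS.err O P f t j ω ^ 2)) (outcomeLaw ν) :=
    integrable_finsetSum _ fun t _ => integrable_finsetSum _ fun j hj => hterm t j hj
  have hgap : Integrable (fun ω => weight S.q T * (objective P f ((hS.method O T).result f ω)
      - objective P f z)) (outcomeLaw ν) := (hres.sub (integrable_const _)).const_mul _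
  have hint := integral_mono (g := fun ω => 4 * S.L * (S.d z - S.d (S.mirror 0 0))
      + ∑ t ∈ Finset.range T, ∑ j ∈ Finset.range ((n + n) * O.batch t),
        (hS.err O P f t j ω * hS.coeff O P f z t j ω
          + stepSize S.q t ^ 2 / ((O.batch t : ℝ) ^ 2 * S.modulus t)
            * hS.err O P f t j ω ^ 2)) hgap ((integrable_const _).add hsum) hpt
  rw [integral_const_mul, integral_sub hres (integrable_const _), integral_add (integrable_const _)
    hsum, integral_const, integral_const, probReal_univ, one_smul, one_smul,
    integral_finsetSum _ fun t _ => integrable_finsetSum _ fun j hj => hterm t j hj] at hint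
  refine hint.trans (add_le_add ?_ ?_)
  · have h1 := hR z hz _ (hS.mirror_mem 0 0)
    have := hS.L_pos
    exact mul_le_mul_of_nonneg_left h1 (by positivity)
  · rw [Finset.mul_sum]
    refine Finset.sum_le_sum fun t ht => ?_
    rw [integral_finsetSum _ fun j hj => hterm t j hj]
    have h1 : ∀ j ∈ Finset.range ((n + n) * O.batch t),
        ∫ ω, (hS.err O P f t j ω * hS.coeff O P f z t j ω
          + stepSize S.q t ^ 2 / ((O.batch t : ℝ) ^ 2 * S.modulus t)
            * hS.err O P f t j ω ^ 2) ∂(outcomeLaw ν)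
        = stepSize S.q t ^ 2 / ((O.batch t : ℝ) ^ 2 * S.modulus t)
          * ∫ ω, hS.err O P f t j ω ^ 2 ∂(outcomeLaw ν) := by
      intro j hj
      rw [integral_add (hlin t j hj).1 (hquad t j hj), (hlin t j hj).2, zero_add,
        integral_const_mul]
    rw [Finset.sum_congr rfl h1, ← Finset.mul_sum]
    have hb' : (0 : ℝ) < O.batch t := Nat.cast_pos.2 (hb t (Finset.mem_range.1 ht))
    have hβ := hS.modulus_pos t
    have hL := hS.L_pos
    calc _ ≤ stepSize S.q t ^ 2 / ((O.batch t : ℝ) ^ 2 * S.modulus t)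
          * (2 * O.batch t * (D + n * δ ^ 2)) :=
          mul_le_mul_of_nonneg_left (hS.sum_integral_err_sq_le O hO hf hD hν t _) (by positivity)
      _ = stepSize S.q t ^ 2 / S.modulus t * (2 * (D + n * δ ^ 2) / O.batch t) := by
          field_simp
      _ ≤ weight S.q (t + 1) / (2 * S.L) * (2 * (D + n * δ ^ 2) / O.batch t) :=
          mul_le_mul_of_nonneg_right (hS.sq_div_modulus_le t) (by positivity)
      _ = _ := by field_simp

end Scheme

/-! ### Cost and accuracy of a parameter choice -/

namespace Scheme

variable {n k : ℕ} {S : Scheme n} {N : Seminorm ℝ (Space n)}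

lemma Valid.totalCalls_method (hS : S.Valid N) (O : Calls n k) (T : ℕ) :
    ((hS.method O T).totalCalls : ℝ) = 2 * n * ∑ t ∈ Finset.range T, (O.batch t : ℝ) := by
  have : (hS.method O T).totalCalls
      = ∑ t ∈ Finset.range T, ∑ _j ∈ Finset.range ((n + n) * O.batch t), 1 := rfl
  rw [this]
  simp only [Finset.sum_const, Finset.card_range, smul_eq_mul, mul_one]
  push_cast
  rw [Finset.mul_sum]
  exact Finset.sum_congr rfl fun t _ => by ring

variable {Ξ : Type*} [MeasurableSpace Ξ] {D δ ε : ℝ} {P : Measure Ξ} {f : Space n → Ξ → ℝ}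
  {ν : Measure (Ξ × (Fin k → ℝ))} [IsProbabilityMeasure P] [IsProbabilityMeasure ν]

lemma Valid.hasAccuracy (hS : S.Valid N) (O : Calls n k)
    (hO : IsPeriodicDesign N O.w O.p) (hf : IsSmoothStochastic N S.Q S.L D P f) (hD : 0 ≤ D)
    (hF : S.Model N (objective P f) (meanGrad P f)) (hν : IsOracleLaw k P δ ν) {R : ℝ}
    (hR : ProxDiameterLE S.Q S.d R) {T : ℕ} (hT : 0 < T) (hb : ∀ t < T, 0 < O.batch t)
    (hε : 4 * S.L * R ^ 2 + (D + n * δ ^ 2) / S.L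
        * ∑ t ∈ Finset.range T, weight S.q (t + 1) / O.batch t ≤ weight S.q T * ε) :
    (hS.method O T).HasAccuracy P f ν ε := by
  refine ⟨hS.integrable_result O hf T, fun z hz => ?_⟩
  obtain ⟨T, rfl⟩ := Nat.exists_eq_succ_of_ne_zero hT.ne'
  exact le_of_mul_le_mul_left ((hS.expected_accuracy O hO hf hD hF hν hR hb hz).trans hε)
    (weight_succ_pos _ _)

lemma Valid.hasAccuracy_zero (hS : S.Valid N) (O : Calls n k)
    (hf : IsSmoothStochastic N S.Q S.L D P f)
    (hε : ∀ z ∈ S.Q, objective P f (S.mirror 0 0) - objective P f z ≤ ε) :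
    (hS.method O 0).HasAccuracy P f ν ε := by
  refine ⟨hS.integrable_result O hf 0, fun z hz => ?_⟩
  change (∫ ω, objective P f ((hS.method O 0).result f ω) ∂(outcomeLaw ν)) - _ ≤ _
  have : ∀ ω, (hS.method O 0).result f ω = S.mirror 0 0 := fun ω => hS.result_eq O f 0 ω
  simp only [this, integral_const, probReal_univ, one_smul]
  exact hε z hz

lemma Valid.growth_mirror_zero (hS : S.Valid N) {v : Space n} (hv : v ∈ S.Q) :
    N (v - S.mirror 0 0) ^ 2 ≤ 2 * (S.d v - S.d (S.mirror 0 0)) := by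
  have h := proxMap_growth hS.convex hS.isCompact hS.nonempty hS.prox 0 hv
  have h0 : S.mirror 0 0 = proxMap S.Q S.d 0 := by rw [mirror, smul_zero]
  rw [h0]
  simp only [inner_zero_left, add_zero] at h
  linarith

end Scheme

lemma IsOracleLaw.mul_sq_le {Ξ : Type*} [MeasurableSpace Ξ] {k n : ℕ} {P : Measure Ξ} {δ L X : ℝ}
    {ν : Measure (Ξ × (Fin k → ℝ))} [IsProbabilityMeasure ν] (hν : IsOracleLaw k P δ ν)
    (i : Fin k) (hn : 0 < n) (hL : 0 < L) (hX : 0 ≤ X) (hδ : δ ≤ √(L / n * X)) :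
    n * δ ^ 2 ≤ L * X := by
  obtain ⟨v, hv⟩ := hν.noise_le.exists
  have h0 : 0 ≤ δ := (abs_nonneg _).trans (hv i)
  have hn' : (0 : ℝ) < n := Nat.cast_pos.2 hn
  have h1 : δ ^ 2 ≤ L / n * X := by
    have := pow_le_pow_left₀ h0 hδ 2
    rwa [Real.sq_sqrt (by positivity)] at this
  calc n * δ ^ 2 ≤ n * (L / n * X) := mul_le_mul_of_nonneg_left h1 hn'.le
    _ = L * X := by field_simp

/-! ### Growth of the weights -/

lemma weight_succ_ge (q : ℝ) (t : ℕ) : (1 + q) * weight q t ≤ weight q (t + 1) := by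
  have : q * weight q t ≤ stepSize q t := le_max_right _ _
  rw [weight_succ]
  linarith

lemma pow_mul_weight_le {q : ℝ} (hq : 0 ≤ q) (t j : ℕ) :
    (1 + q) ^ j * weight q t ≤ weight q (t + j) := by
  induction j with
  | zero => simp
  | succ j ih =>
    calc (1 + q) ^ (j + 1) * weight q t = (1 + q) * ((1 + q) ^ j * weight q t) := by ring
      _ ≤ (1 + q) * weight q (t + j) := mul_le_mul_of_nonneg_left ih (by linarith)
      _ ≤ _ := weight_succ_ge q (t + j)

/-- The square roots of the weights form an essentially geometric sequence. -/
lemma sum_sqrt_weight_le {q : ℝ} (hq : 0 < q) (hq1 : q ≤ 1) (T : ℕ) :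
    ∑ t ∈ Finset.range T, √(weight q (t + 1)) ≤ 4 / q * √(weight q T) := by
  induction T with
  | zero => simp [weight]
  | succ T ih =>
    rw [Finset.sum_range_succ]
    have h1 : √(weight q T) ≤ (1 - q / 4) * √(weight q (T + 1)) := by
      refine Real.sqrt_le_iff.2 ⟨mul_nonneg (by linarith) (Real.sqrt_nonneg _), ?_⟩
      rw [mul_pow, Real.sq_sqrt (weight_nonneg _ _)]
      refine le_trans ?_ (mul_le_mul_of_nonneg_left (weight_succ_ge q T) (sq_nonneg _))
      rw [← mul_assoc]
      refine le_mul_of_one_le_left (weight_nonneg _ _) ?_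
      nlinarith [mul_nonneg hq.le (sub_nonneg.2 hq1), mul_pos hq hq, mul_pos hq (mul_pos hq hq)]
    have h2 := mul_le_mul_of_nonneg_left h1 (by positivity : 0 ≤ 4 / q)
    have h3 : 4 / q * ((1 - q / 4) * √(weight q (T + 1)))
        = 4 / q * √(weight q (T + 1)) - √(weight q (T + 1)) := by
      field_simp
    linarith

lemma ceil_max_le_two_mul {a b : ℝ} (hb : 1 ≤ b) : (⌈max a b⌉₊ : ℝ) ≤ 2 * max a b := by
  have h1 : 1 ≤ max a b := hb.trans (le_max_right _ _)
  have := (Nat.ceil_lt_add_one (zero_le_one.trans h1)).le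
  linarith

/-! ### Parameters in the convex case -/

section ConvexRate

variable {θ s : ℝ}

/-- The number of iterations in the convex case. -/
noncomputable def convexSteps (θ : ℝ) : ℕ := ⌈4 * √θ⌉₊

/-- The number of repetitions of the design in the convex case. The first bound averages out the
variance; the second one, which is governed by `p` through `s = 1 / (p + 1)`, the oracle noise. -/
noncomputable def convexBatch (θ s L D ε : ℝ) : ℕ := ⌈max (20 * √θ * D / (L * ε)) (θ ^ (s - 1 / 2))⌉₊

lemma convexSteps_le (hθ : 1 ≤ θ) : (convexSteps θ : ℝ) ≤ 5 * √θ := by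
  have h1 : 1 ≤ √θ := Real.one_le_sqrt.2 hθ
  have := (Nat.ceil_lt_add_one (by positivity : 0 ≤ 4 * √θ)).le
  rw [convexSteps]
  linarith

lemma sqrt_mul_rpow (hθ : 0 < θ) : √θ * θ ^ (s - 1 / 2) = θ ^ s := by
  rw [Real.sqrt_eq_rpow, ← Real.rpow_add hθ]
  congr 1
  ring

lemma sqrt_le_rpow (hθ : 1 ≤ θ) (hs : 1 / 2 ≤ s) : √θ ≤ θ ^ s := by
  rw [Real.sqrt_eq_rpow]
  exact Real.rpow_le_rpow_of_exponent_le hθ hs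

lemma one_le_rpow_sub (hθ : 1 ≤ θ) (hs : 1 / 2 ≤ s) : 1 ≤ θ ^ (s - 1 / 2) :=
  Real.one_le_rpow hθ (by linarith)

lemma convex_calls_le {L D R ε : ℝ} (hL : 0 < L) (hε : 0 < ε)
    (hθ : θ = L * R ^ 2 / ε) (h1 : 1 ≤ θ) (hs : 1 / 2 ≤ s) :
    (convexSteps θ : ℝ) * convexBatch θ s L D ε
      ≤ max (200 * θ ^ s) (200 * (D * R ^ 2 / ε ^ 2)) := by
  have hT := convexSteps_le h1
  have hb := ceil_max_le_two_mul (a := 20 * √θ * D / (L * ε)) (one_le_rpow_sub h1 hs)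
  have hnn : 0 ≤ max (20 * √θ * D / (L * ε)) (θ ^ (s - 1 / 2)) :=
    le_max_of_le_right (by positivity)
  calc (convexSteps θ : ℝ) * convexBatch θ s L D ε
      ≤ (5 * √θ) * (2 * max (20 * √θ * D / (L * ε)) (θ ^ (s - 1 / 2))) :=
        mul_le_mul hT hb (Nat.cast_nonneg _) (by positivity)
    _ = 10 * max (√θ * (20 * √θ * D / (L * ε))) (√θ * θ ^ (s - 1 / 2)) := by
        rw [← mul_max_of_nonneg _ _ (Real.sqrt_nonneg θ)]
        ring
    _ = 10 * max (20 * (D * R ^ 2 / ε ^ 2)) (θ ^ s) := by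
        rw [sqrt_mul_rpow (by linarith)]
        congr 2
        have : √θ * √θ = L * R ^ 2 / ε := by rw [Real.mul_self_sqrt (by linarith), hθ]
        calc √θ * (20 * √θ * D / (L * ε)) = (√θ * √θ) * (20 * D / (L * ε)) := by ring
          _ = _ := by rw [this]; field_simp
    _ ≤ _ := by
        have h2 : 0 ≤ θ ^ s := by positivity
        rcases max_cases (20 * (D * R ^ 2 / ε ^ 2)) (θ ^ s) with h | h
        · rw [h.1]; exact le_max_of_le_right (by linarith)
        · rw [h.1]; exact le_max_of_le_left (by linarith)

lemma convex_rate {L D R ε Y : ℝ} (hL : 0 < L) (hD : 0 ≤ D) (hε : 0 < ε)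
    (hθ : θ = L * R ^ 2 / ε) (h1 : 1 ≤ θ) (hs : 1 / 2 ≤ s)
    (hY : Y ≤ L * (1 / 24 * (ε * θ ^ (s - 1)))) :
    4 * L * R ^ 2 + (D + Y) / L
        * ∑ t ∈ Finset.range (convexSteps θ), weight 0 (t + 1) / convexBatch θ s L D ε
      ≤ weight 0 (convexSteps θ) * ε := by
  have hT := convexSteps_le h1
  have hT' : 4 * √θ ≤ convexSteps θ := Nat.le_ceil _
  have hA := weight_ge 0 (convexSteps θ)
  have hB1 : 20 * √θ * D / (L * ε) ≤ convexBatch θ s L D ε :=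
    (le_max_left _ _).trans (Nat.le_ceil _)
  have hB2 : θ ^ (s - 1 / 2) ≤ convexBatch θ s L D ε := (le_max_right _ _).trans (Nat.le_ceil _)
  have hB3 := one_le_rpow_sub h1 hs
  set b : ℝ := (convexBatch θ s L D ε : ℝ)
  set T := convexSteps θ
  have hb : 0 < b := by linarith
  have hLR : L * R ^ 2 = θ * ε := by rw [hθ]; field_simp
  have hAθ : 8 * θ ≤ weight 0 T := by
    have h2 : √θ * √θ = θ := Real.mul_self_sqrt (by linarith)
    have h3 : (0 : ℝ) ≤ √θ := Real.sqrt_nonneg _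
    have h4 : (4 * √θ) * (4 * √θ) ≤ (T : ℝ) * T := mul_le_mul hT' hT' (by positivity) (by positivity)
    have h5 : (0 : ℝ) ≤ T := Nat.cast_nonneg _
    nlinarith
  -- the variance part
  have hDT : D * T ≤ L * ε * b / 4 := by
    rw [div_le_iff₀ (by positivity)] at hB1
    have := mul_le_mul_of_nonneg_left hT hD
    linarith
  -- the noise part
  have hYT : Y * T ≤ L * ε * b / 4 := by
    have h2 : θ ^ (s - 1) * √θ = θ ^ (s - 1 / 2) := by
      rw [Real.sqrt_eq_rpow, ← Real.rpow_add (by linarith)]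
      congr 1
      ring
    have h3 : Y * T ≤ L * (1 / 24 * (ε * θ ^ (s - 1))) * (5 * √θ) :=
      (mul_le_mul_of_nonneg_right hY (Nat.cast_nonneg _)).trans
        (mul_le_mul_of_nonneg_left hT (by positivity))
    have h4 : L * (1 / 24 * (ε * θ ^ (s - 1))) * (5 * √θ) = 5 / 24 * (L * ε * θ ^ (s - 1 / 2)) := by
      rw [← h2]; ring
    have h5 := mul_le_mul_of_nonneg_left hB2 (by positivity : 0 ≤ L * ε)
    have h6 : 0 ≤ L * ε * b := by positivity
    linarith
  have hsum : ∑ t ∈ Finset.range T, weight 0 (t + 1) / b ≤ T * (weight 0 T / b) := by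
    have h2 : ∀ t ∈ Finset.range T, weight 0 (t + 1) / b ≤ weight 0 T / b := fun t ht =>
      div_le_div_of_nonneg_right (monotone_weight 0 (Finset.mem_range.1 ht)) hb.le
    simpa using Finset.sum_le_sum h2
  have hA0 := weight_nonneg 0 T
  rcases le_or_gt 0 (D + Y) with hDY | hDY
  · have h2 := mul_le_mul_of_nonneg_left hsum (div_nonneg hDY hL.le)
    have h3 : (D + Y) / L * (T * (weight 0 T / b)) ≤ weight 0 T * (ε / 2) := by
      rw [show (D + Y) / L * (T * (weight 0 T / b)) = weight 0 T * ((D + Y) * T / (L * b)) by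
        field_simp]
      refine mul_le_mul_of_nonneg_left ?_ hA0
      rw [div_le_iff₀ (by positivity)]
      linarith
    nlinarith
  · have h2 : (D + Y) / L * ∑ t ∈ Finset.range T, weight 0 (t + 1) / b ≤ 0 :=
      mul_nonpos_of_nonpos_of_nonneg (div_nonpos_of_nonpos_of_nonneg hDY.le hL.le)
        (Finset.sum_nonneg fun t _ => div_nonneg (weight_nonneg _ _) hb.le)
    nlinarith

end ConvexRate

/-! ### Parameters in the strongly convex case -/

section StrongRate

/-- The growth rate of the weights in the strongly convex case. -/
noncomputable def strongRate (L μ : ℝ) : ℝ := √(μ / (2 * L))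

/-- The number of iterations in the strongly convex case: each block of `⌈1 / q⌉` iterations after
the first one doubles the weight. -/
noncomputable def strongSteps (L μ : ℝ) (l : ℕ) : ℕ := ⌈1 / strongRate L μ⌉₊ * (1 + 5 * l)

/-- The number of repetitions of the design in iteration `t` of `T` in the strongly convex case: the
part that averages out the variance grows like the square root of the weight. -/
noncomputable def strongBatch (L μ s D ε : ℝ) (T t : ℕ) : ℕ :=
  ⌈max (16 * D / (strongRate L μ * L * ε)
      * (√(weight (strongRate L μ) (t + 1)) / √(weight (strongRate L μ) T)))
    ((L / μ) ^ (s - 1 / 2))⌉₊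

variable {L μ s D ε : ℝ}

lemma strongRate_pos (hL : 0 < L) (hμ : 0 < μ) : 0 < strongRate L μ :=
  Real.sqrt_pos.2 (by positivity)

lemma strongRate_sq (hL : 0 < L) (hμ : 0 < μ) : strongRate L μ ^ 2 = μ / (2 * L) :=
  Real.sq_sqrt (by positivity)

lemma strongRate_le_one (hL : 0 < L) (hμL : μ ≤ L) : strongRate L μ ≤ 1 := by
  refine Real.sqrt_le_one.2 ?_
  rw [div_le_one (by positivity)]
  linarith

/-- The rate is `√(μ / L)` up to a constant. -/
lemma strongRate_mul_sqrt (hL : 0 < L) (hμ : 0 < μ) :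
    2 / 3 ≤ strongRate L μ * √(L / μ) ∧ strongRate L μ * √(L / μ) ≤ 1 := by
  have h : strongRate L μ * √(L / μ) = √(1 / 2) := by
    rw [strongRate, ← Real.sqrt_mul (by positivity)]
    congr 1
    field_simp
  rw [h]
  refine ⟨Real.le_sqrt_of_sq_le (by norm_num), Real.sqrt_le_one.2 (by norm_num)⟩

lemma strongSteps_le (hL : 0 < L) (hμ : 0 < μ) (hμL : μ ≤ L) {l : ℕ} (hl : 1 ≤ l) :
    (strongSteps L μ l : ℝ) ≤ 18 * (√(L / μ) * l) := by
  have hq := strongRate_pos hL hμ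
  have hq1 := strongRate_le_one hL hμL
  have hl' : (1 : ℝ) ≤ l := Nat.one_le_cast.2 hl
  have h1 : (⌈1 / strongRate L μ⌉₊ : ℝ) ≤ 3 * √(L / μ) := by
    have h2 := (Nat.ceil_lt_add_one (by positivity : 0 ≤ 1 / strongRate L μ)).le
    have h3 : 1 ≤ 1 / strongRate L μ := (one_le_div hq).2 hq1
    have h4 : 1 / strongRate L μ ≤ 3 / 2 * √(L / μ) := by
      rw [div_le_iff₀ hq]
      linarith [(strongRate_mul_sqrt hL hμ).1]
    linarith
  rw [strongSteps]
  push_cast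
  calc (⌈1 / strongRate L μ⌉₊ : ℝ) * (1 + 5 * l) ≤ (3 * √(L / μ)) * (6 * l) :=
        mul_le_mul h1 (by linarith) (by positivity) (by positivity)
    _ = _ := by ring

lemma strongSteps_pos (hL : 0 < L) (hμ : 0 < μ) (l : ℕ) : 0 < strongSteps L μ l := by
  have := strongRate_pos hL hμ
  exact Nat.mul_pos (Nat.ceil_pos.2 (by positivity)) (by omega)

/-- The first block of iterations brings the weight to `L / μ`; the following ones double it. -/
lemma weight_strongSteps_ge (hL : 0 < L) (hμ : 0 < μ) (l : ℕ) :
    2 ^ (5 * l) * (L / μ) ≤ weight (strongRate L μ) (strongSteps L μ l) := by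
  have hq := strongRate_pos hL hμ
  have hq2 := strongRate_sq hL hμ
  have hm : 1 / strongRate L μ ≤ ⌈1 / strongRate L μ⌉₊ := Nat.le_ceil _
  rw [strongSteps]
  set q := strongRate L μ
  set m := ⌈1 / q⌉₊
  have h1 : L / μ ≤ weight q m := by
    refine le_trans ?_ (weight_ge q m)
    have h2 : L / μ = (1 / q) * (1 / q) / 2 := by
      rw [div_mul_div_comm, ← sq q, hq2]
      field_simp
    rw [h2]
    have : (1 / q) * (1 / q) ≤ (m : ℝ) * m := mul_le_mul hm hm (by positivity) (by positivity)
    have : (0 : ℝ) ≤ m := Nat.cast_nonneg _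
    linarith
  have h2 : (2 : ℝ) ≤ (1 + q) ^ m := by
    have h3 := one_add_mul_le_pow (by linarith : -2 ≤ q) m
    have h4 : 1 ≤ m * q := by rwa [div_le_iff₀ hq] at hm
    linarith
  calc 2 ^ (5 * l) * (L / μ) ≤ ((1 + q) ^ m) ^ (5 * l) * weight q m :=
        mul_le_mul (pow_le_pow_left₀ (by norm_num) h2 _) h1 (by positivity) (by positivity)
    _ = (1 + q) ^ (m * (5 * l)) * weight q m := by rw [← pow_mul]
    _ ≤ weight q (m + m * (5 * l)) := pow_mul_weight_le hq.le _ _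
    _ = _ := by rw [mul_add, mul_one]

lemma eight_mul_le_two_pow {x : ℝ} (hx : 0 < x) {l : ℕ} (hl : 1 ≤ l) (hlog : Real.log x ≤ l) :
    8 * x ≤ 2 ^ (5 * l) := by
  have h1 : x ≤ 4 ^ l := by
    calc x = Real.exp (Real.log x) := (Real.exp_log hx).symm
      _ ≤ Real.exp l := Real.exp_le_exp.2 hlog
      _ = Real.exp 1 ^ l := by rw [← Real.exp_nat_mul, mul_one]
      _ ≤ 4 ^ l := pow_le_pow_left₀ (Real.exp_pos 1).le
          (by linarith [Real.exp_one_lt_d9]) l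
  have h2 : (8 : ℝ) ≤ 8 ^ l := le_self_pow₀ (by norm_num) (by omega)
  calc 8 * x ≤ 8 ^ l * 4 ^ l := mul_le_mul h2 h1 hx.le (by positivity)
    _ = 2 ^ (5 * l) := by rw [← mul_pow, pow_mul]; norm_num

lemma sum_ratio_le (hL : 0 < L) (hμ : 0 < μ) (hμL : μ ≤ L) {T : ℕ} (hT : 0 < T) :
    ∑ t ∈ Finset.range T,
      √(weight (strongRate L μ) (t + 1)) / √(weight (strongRate L μ) T) ≤ 4 / strongRate L μ := by
  obtain ⟨T, rfl⟩ := Nat.exists_eq_succ_of_ne_zero hT.ne'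
  rw [← Finset.sum_div, div_le_iff₀ (Real.sqrt_pos.2 (weight_succ_pos _ _))]
  exact sum_sqrt_weight_le (strongRate_pos hL hμ) (strongRate_le_one hL hμL) _

lemma strong_calls_le (hL : 0 < L) (hμ : 0 < μ) (hμL : μ ≤ L) (hD : 0 ≤ D) (hε : 0 < ε)
    (hs : 1 / 2 ≤ s) {l : ℕ} (hl : 1 ≤ l) :
    ∑ t ∈ Finset.range (strongSteps L μ l),
        (strongBatch L μ s D ε (strongSteps L μ l) t : ℝ)
      ≤ max (300 * ((L / μ) ^ s * l)) (300 * (D / (μ * ε))) := by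
  have hq := strongRate_pos hL hμ
  have hq2 := strongRate_sq hL hμ
  have hκ : 1 ≤ L / μ := (one_le_div hμ).2 hμL
  have hT := strongSteps_le hL hμ hμL hl
  have hsum := sum_ratio_le hL hμ hμL (strongSteps_pos hL hμ l)
  set T := strongSteps L μ l
  set q := strongRate L μ
  set B := 16 * D / (q * L * ε) with hB
  have hB0 : 0 ≤ B := by positivity
  have h1 : ∀ t, (strongBatch L μ s D ε T t : ℝ)
      ≤ 2 * (B * (√(weight q (t + 1)) / √(weight q T)) + (L / μ) ^ (s - 1 / 2)) := by
    intro t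
    refine (ceil_max_le_two_mul (one_le_rpow_sub hκ hs)).trans ?_
    refine mul_le_mul_of_nonneg_left (max_le_add_of_nonneg ?_ ?_) (by norm_num) <;> positivity
  have h2 : ∑ t ∈ Finset.range T, (strongBatch L μ s D ε T t : ℝ)
      ≤ 2 * (B * (4 / q) + T * (L / μ) ^ (s - 1 / 2)) := by
    refine (Finset.sum_le_sum fun t _ => h1 t).trans ?_
    rw [← Finset.mul_sum, Finset.sum_add_distrib, ← Finset.mul_sum, Finset.sum_const,
      Finset.card_range, nsmul_eq_mul]
    have := mul_le_mul_of_nonneg_left hsum hB0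
    linarith
  have h3 : B * (4 / q) = 128 * (D / (μ * ε)) := by
    rw [hB, div_mul_div_comm]
    rw [show q * L * ε * q = q ^ 2 * (L * ε) by ring, hq2]
    field_simp
    ring
  have h4 : T * (L / μ) ^ (s - 1 / 2) ≤ 18 * ((L / μ) ^ s * l) := by
    rw [← sqrt_mul_rpow (θ := L / μ) (s := s) (by positivity)]
    have := mul_le_mul_of_nonneg_right hT (by positivity : 0 ≤ (L / μ) ^ (s - 1 / 2))
    linarith
  rw [h3] at h2
  have h5 : 0 ≤ (L / μ) ^ s * l := by positivity
  have h6 : 0 ≤ D / (μ * ε) := by positivity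
  rcases le_total ((L / μ) ^ s * l) (D / (μ * ε)) with h | h
  · exact le_max_of_le_right (by linarith)
  · exact le_max_of_le_left (by linarith)

lemma strong_rate (hL : 0 < L) (hμ : 0 < μ) (hμL : μ ≤ L) (hε : 0 < ε)
    (hs : 1 / 2 ≤ s) {l : ℕ} (hl : 1 ≤ l) {R Y : ℝ} (hR : 0 < R)
    (hlog : Real.log (μ * R ^ 2 / ε) ≤ l) (hY0 : 0 ≤ Y)
    (hY : Y ≤ L * (1 / 24 * (ε * (L / μ) ^ (s - 1)))) :
    4 * L * R ^ 2 + (D + Y) / L * ∑ t ∈ Finset.range (strongSteps L μ l),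
        weight (strongRate L μ) (t + 1) / strongBatch L μ s D ε (strongSteps L μ l) t
      ≤ weight (strongRate L μ) (strongSteps L μ l) * ε := by
  have hq := strongRate_pos hL hμ
  have hκ : 1 ≤ L / μ := (one_le_div hμ).2 hμL
  have hTpos := strongSteps_pos hL hμ l
  have hsum := sum_ratio_le hL hμ hμL hTpos
  have hpow := eight_mul_le_two_pow (by positivity) hl hlog
  have hA := weight_strongSteps_ge hL hμ l
  have hqκ := (strongRate_mul_sqrt hL hμ).1
  have hbatch : ∀ t, max _ _ ≤ (strongBatch L μ s D ε (strongSteps L μ l) t : ℝ) := fun t =>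
    Nat.le_ceil _
  set T := strongSteps L μ l
  set q := strongRate L μ
  have hApos : 0 < weight q T := lt_of_lt_of_le (by positivity) hA
  have h1 : 8 * L * R ^ 2 ≤ weight q T * ε := by
    have h2 := mul_le_mul_of_nonneg_right hpow (by positivity : 0 ≤ L / μ)
    have h3 := mul_le_mul_of_nonneg_right (h2.trans hA) hε.le
    have h4 : 8 * (μ * R ^ 2 / ε) * (L / μ) * ε = 8 * L * R ^ 2 := by field_simp
    linarith
  have hterm : ∀ t ∈ Finset.range T,
      (D + Y) / L * (weight q (t + 1) / strongBatch L μ s D ε T t)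
        ≤ weight q T * (q * ε / 8) * (√(weight q (t + 1)) / √(weight q T)) := by
    intro t ht
    have hb1 := (le_max_left _ _).trans (hbatch t)
    have hb2 := (le_max_right _ _).trans (hbatch t)
    have hb3 := one_le_rpow_sub hκ hs
    set b : ℝ := (strongBatch L μ s D ε T t : ℝ)
    have hb : 0 < b := by linarith
    have hr : weight q (t + 1) = weight q T * (√(weight q (t + 1)) / √(weight q T)) ^ 2 := by
      rw [div_pow, Real.sq_sqrt (weight_nonneg _ _), Real.sq_sqrt hApos.le]
      field_simp
    have hr1 : √(weight q (t + 1)) / √(weight q T) ≤ 1 := by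
      rw [div_le_one (Real.sqrt_pos.2 hApos)]
      exact Real.sqrt_le_sqrt (monotone_weight q (Finset.mem_range.1 ht))
    have hr0 : 0 ≤ √(weight q (t + 1)) / √(weight q T) := by positivity
    set r := √(weight q (t + 1)) / √(weight q T)
    -- the variance part
    have hDb : D * r ≤ L * b * (q * ε / 16) := by
      rw [div_mul_eq_mul_div, div_le_iff₀ (by positivity)] at hb1
      linarith
    -- the noise part
    have hYb : Y ≤ L * b * (q * ε / 16) := by
      have h2 : (L / μ) ^ (s - 1) = (L / μ) ^ (s - 1 / 2) / √(L / μ) := by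
        rw [Real.sqrt_eq_rpow, ← Real.rpow_sub (by positivity)]
        congr 1
        ring
      have h3 : (L / μ) ^ (s - 1) ≤ b * (3 / 2 * q) := by
        rw [h2, div_le_iff₀ (by positivity)]
        have h4 : 1 ≤ 3 / 2 * (q * √(L / μ)) := by linarith
        calc (L / μ) ^ (s - 1 / 2) ≤ b * 1 := by linarith
          _ ≤ b * (3 / 2 * (q * √(L / μ))) := mul_le_mul_of_nonneg_left h4 hb.le
          _ = _ := by ring
      have h5 := mul_le_mul_of_nonneg_left h3 (by positivity : 0 ≤ L * (1 / 24 * ε))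
      linarith
    have hDY : (D + Y) * r ≤ L * b * (q * ε / 8) := by
      have : Y * r ≤ Y := mul_le_of_le_one_right hY0 hr1
      linarith
    calc (D + Y) / L * (weight q (t + 1) / b) = weight q T * r * ((D + Y) * r / (L * b)) := by
          rw [hr]; field_simp
      _ ≤ weight q T * r * (q * ε / 8) := by
          refine mul_le_mul_of_nonneg_left ?_ (by positivity)
          rw [div_le_iff₀ (by positivity)]
          linarith
      _ = _ := by ring
  have h2 : (D + Y) / L * ∑ t ∈ Finset.range T, weight q (t + 1) / strongBatch L μ s D ε T t
      ≤ weight q T * (q * ε / 8) * (4 / q) := by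
    rw [Finset.mul_sum]
    refine (Finset.sum_le_sum hterm).trans ?_
    rw [← Finset.mul_sum]
    exact mul_le_mul_of_nonneg_left hsum (by positivity)
  have h3 : weight q T * (q * ε / 8) * (4 / q) = weight q T * ε / 2 := by
    field_simp
    norm_num
  linarith

end StrongRate

/-! ### The two families of methods -/

lemma half_le_one_div {p : ℝ} (hp : p ∈ Set.Icc (0 : ℝ) 1) : 1 / 2 ≤ 1 / (p + 1) :=
  one_div_le_one_div_of_le (by linarith [hp.1]) (by linarith [hp.2])

/-- The exponent of the noise level in terms of `s = 1 / (p + 1)`. -/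
lemma inv_rpow_div {x p : ℝ} (hx : 0 ≤ x) (hp : 0 ≤ p) :
    x⁻¹ ^ (p / (p + 1)) = x ^ (1 / (p + 1) - 1) := by
  rw [Real.inv_rpow hx, ← Real.rpow_neg hx]
  congr 1
  field_simp
  ring

lemma half_le_div {n k : ℕ} (hn : 1 ≤ n) (hk : 1 ≤ k) (hkn : k ≤ n + 1) :
    (1 : ℝ) / 2 ≤ n / k := by
  rw [div_le_div_iff₀ two_pos (Nat.cast_pos.2 hk)]
  exact_mod_cast (by omega : 1 * k ≤ n * 2)

lemma norm_sub_sq_eq_bregman {n : ℕ} (c x z : Space n) :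
    euclideanProx c z - euclideanProx c x - inner ℝ (x - c) (z - x) = ‖z - x‖ ^ 2 / 2 := by
  have h : z - c = (x - c) + (z - x) := by abel
  rw [euclideanProx, euclideanProx, h, norm_add_sq_real]
  ring

lemma isProxFunction_euclideanProx {n : ℕ} (c : Space n) (Q : Set (Space n)) :
    IsProxFunction (normSeminorm ℝ (Space n)) Q (euclideanProx c) where
  continuousOn := by unfold euclideanProx; fun_prop
  strongConvex x _ y _ a b _ _ hab := by
    have h1 : a • x + b • y - c = a • (x - c) + b • (y - c) := by
      rw [smul_sub, smul_sub, sub_add_sub_comm, ← add_smul, hab, one_smul]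
    have h2 : x - y = (x - c) - (y - c) := by abel
    rw [coe_normSeminorm, euclideanProx, euclideanProx, euclideanProx, h1, h2]
    generalize x - c = x, y - c = y
    rw [norm_add_sq_real,
      norm_sub_sq_real, norm_smul, norm_smul, inner_smul_left, inner_smul_right,
      RCLike.conj_to_real, mul_pow, mul_pow, Real.norm_eq_abs, Real.norm_eq_abs, sq_abs, sq_abs]
    obtain rfl : b = 1 - a := by linarith
    apply le_of_eq
    ring

/-- The smoothness part of the model of the objective. -/
lemma IsSmoothStochastic.model {n : ℕ} {Ξ : Type*} [MeasurableSpace Ξ] {S : Scheme n}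
    {N : Seminorm ℝ (Space n)} {D : ℝ} {P : Measure Ξ} [IsProbabilityMeasure P]
    {f : Space n → Ξ → ℝ} (hS : S.Valid N) (hf : IsSmoothStochastic N S.Q S.L D P f)
    (hlower : ∀ x ∈ S.Q, ∀ z ∈ S.Q, objective P f x + inner ℝ (meanGrad P f x) (z - x)
      + S.μ * (S.d z - S.d x - inner ℝ (x - S.x₀) (z - x)) ≤ objective P f z) :
    S.Model N (objective P f) (meanGrad P f) where
  upper x hx y hy := by
    have := (abs_le.1 (hf.abs_objective_remainder_le hS.le_norm hS.convex hx hy)).2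
    linarith
  lower := hlower

/-- The convex case. For `ε ≤ L R²` about `4 √(L R² / ε)` iterations are made, whatever `p` is; the
parameter `p` enters only through the number of repetitions in each iteration. -/
theorem exists_convex_methods {n k : ℕ} (hn : 1 ≤ n) (hk : 1 ≤ k) (hkn : k ≤ n + 1)
    (N : Seminorm ℝ (Space n)) (Q : Set (Space n)) (d : Space n → ℝ) (L D R ε : ℝ)
    (hN : ∀ x, ‖x‖ ≤ N x) (hQc : Convex ℝ Q) (hQ : IsCompact Q) (hQn : Q.Nonempty)
    (hd : IsProxFunction N Q d) (hR : ProxDiameterLE Q d R) (hL : 0 < L) (hD : 0 ≤ D)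
    (hR0 : 0 < R) (hε : 0 < ε) :
    ∃ M : Set.Icc (0 : ℝ) 1 → Method n k Q, ∀ p : Set.Icc (0 : ℝ) 1,
      ((M p).totalCalls : ℝ) ≤ n * max (1000 * (L * R ^ 2 / ε) ^ (1 / ((p : ℝ) + 1)))
        (1000 * (D * R ^ 2 / ε ^ 2)) ∧
      ((M p).iterations : ℝ) ≤
        (n : ℝ) / k * (1000 * (L * R ^ 2 / ε) ^ (1 / ((p : ℝ) + 1))) ∧
      ∀ (Ξ : Type*) [MeasurableSpace Ξ] (P : Measure Ξ) [IsProbabilityMeasure P]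
        (f : Space n → Ξ → ℝ) (δ : ℝ) (ν : Measure (Ξ × (Fin k → ℝ))) [IsProbabilityMeasure ν],
        IsSmoothStochastic N Q L D P f → ConvexOn ℝ Q (objective P f) →
        (ε ≤ L * R ^ 2 ∨ ∃ x ∈ Q, meanGrad P f x = 0) → IsOracleLaw k P δ ν →
        δ ≤ √(L / n * (1 / 24 * (ε * (ε / (L * R ^ 2)) ^ ((p : ℝ) / ((p : ℝ) + 1))))) →
        (M p).HasAccuracy P f ν ε := by
  obtain ⟨w, v, hwv⟩ := exists_periodicDesign hn hN
  set S : Scheme n := ⟨Q, d, 0, L, 0, 0⟩ with hSdef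
  have hS : S.Valid N := ⟨hN, hQc, hQ, hQn, hd, hL, le_rfl, le_rfl, by simp [hSdef], by simp [hSdef]⟩
  set θ := L * R ^ 2 / ε with hθ
  have hθ0 : 0 < θ := by positivity
  set O : ℝ → Calls n k := fun p => ⟨w, v, EuclideanSpace.single ⟨0, hn⟩ 1, by simp,
    fun _ => convexBatch θ (1 / (p + 1)) L D ε, ⟨0, hk⟩, rfl⟩ with hO
  -- with an accuracy above `L R²` the prox-centre is good enough
  set T : ℕ := if ε ≤ L * R ^ 2 then convexSteps θ else 0 with hT
  refine ⟨fun p => hS.method (O p) T, fun p => ⟨?_, ?_, ?_⟩⟩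
  · have hs := half_le_one_div p.2
    change ((hS.method (O p) T).totalCalls : ℝ) ≤ _
    rw [hS.totalCalls_method]
    simp only [hO, Finset.sum_const, Finset.card_range, nsmul_eq_mul]
    have h1 : 0 ≤ θ ^ (1 / ((p : ℝ) + 1)) := by positivity
    have h2 : 0 ≤ D * R ^ 2 / ε ^ 2 := by positivity
    have h3 : (T : ℝ) * convexBatch θ (1 / ((p : ℝ) + 1)) L D ε
        ≤ max (200 * θ ^ (1 / ((p : ℝ) + 1))) (200 * (D * R ^ 2 / ε ^ 2)) := by
      rw [hT]
      split_ifs with h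
      · exact convex_calls_le hL hε hθ ((one_le_div hε).2 h) hs
      · rw [Nat.cast_zero, zero_mul]
        exact le_max_of_le_left (by positivity)
    have h4 : max (200 * θ ^ (1 / ((p : ℝ) + 1))) (200 * (D * R ^ 2 / ε ^ 2))
        ≤ max (1000 * θ ^ (1 / ((p : ℝ) + 1))) (1000 * (D * R ^ 2 / ε ^ 2)) / 2 := by
      rw [le_div_iff₀ two_pos, max_mul_of_nonneg _ _ two_pos.le]
      exact max_le_max (by linarith) (by linarith)
    rw [mul_comm (2 : ℝ), mul_assoc]
    exact mul_le_mul_of_nonneg_left (by linarith) n.cast_nonneg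
  · have hs := half_le_one_div p.2
    change (T : ℝ) ≤ _
    have h1 : 0 ≤ θ ^ (1 / ((p : ℝ) + 1)) := by positivity
    have h2 := mul_le_mul_of_nonneg_right (half_le_div hn hk hkn)
      (by positivity : 0 ≤ 1000 * θ ^ (1 / ((p : ℝ) + 1)))
    refine le_trans ?_ h2
    rw [hT]
    split_ifs with h
    · have h3 := (one_le_div hε).2 h
      linarith [convexSteps_le h3, sqrt_le_rpow h3 hs]
    · rw [Nat.cast_zero]; positivity
  · intro Ξ _ P _ f δ ν _ hf hconv hcase hν hδ
    have hs := half_le_one_div p.2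
    have hlow : ∀ x ∈ Q, ∀ z ∈ Q,
        objective P f x + inner ℝ (meanGrad P f x) (z - x) ≤ objective P f z := by
      intro x hx z hz
      have := hf.objective_ge hN hQc (strongConvexOn_zero.2 hconv) hx hz
      simpa using this
    change (hS.method (O p) T).HasAccuracy P f ν ε
    by_cases h : ε ≤ L * R ^ 2
    · have h1 : 1 ≤ θ := (one_le_div hε).2 h
      have hT' : T = convexSteps θ := if_pos h
      have hY : n * δ ^ 2 ≤ L * (1 / 24 * (ε * θ ^ (1 / ((p : ℝ) + 1) - 1))) := by
        refine hν.mul_sq_le ⟨0, hk⟩ hn hL (by positivity) ?_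
        rw [← inv_rpow_div hθ0.le p.2.1, hθ, inv_div]
        exact hδ
      have hTpos : 0 < T := by
        rw [hT']
        exact Nat.ceil_pos.2 (by positivity)
      refine hS.hasAccuracy (O p) hwv hf hD
        (hf.model hS fun x hx z hz => by simpa [hSdef] using hlow x hx z hz) hν hR hTpos
        (fun t _ => ?_) ?_
      · exact Nat.ceil_pos.2 (lt_max_of_lt_right (by positivity))
      · rw [hT']
        exact convex_rate hL hD hε hθ h1 hs hY
    · have hT' : T = 0 := if_neg h
      obtain ⟨x, hx, hgx⟩ := hcase.resolve_left h
      rw [hT']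
      refine hS.hasAccuracy_zero (O p) hf fun z hz => ?_
      have hu := hS.mirror_mem 0 0
      have h1 := (abs_le.1 (hf.abs_objective_remainder_le hN hQc hx hu)).2
      have h2 := hlow x hx z hz
      have h3 := hS.growth_mirror_zero hx
      have h4 : d x - d (S.mirror 0 0) ≤ R ^ 2 := hR x hx _ hu
      rw [hgx, inner_zero_left] at h1 h2
      rw [map_sub_rev] at h1
      have h5 : L / 2 * N (x - S.mirror 0 0) ^ 2 ≤ L / 2 * (2 * R ^ 2) :=
        mul_le_mul_of_nonneg_left (h3.trans (by linarith)) (by positivity)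
      linarith

/-- The strongly convex case: one run of the method, whose weights grow polynomially up to `L / μ` and
geometrically from there on. -/
theorem exists_strongConvex_methods {n k : ℕ} (hn : 1 ≤ n) (hk : 1 ≤ k) (hkn : k ≤ n + 1)
    (Q : Set (Space n)) (x₀ : Space n) (L D R μ ε : ℝ)
    (hQc : Convex ℝ Q) (hQ : IsCompact Q) (hQn : Q.Nonempty)
    (hR : ProxDiameterLE Q (euclideanProx x₀) R) (hL : 0 < L) (hD : 0 ≤ D)
    (hR0 : 0 < R) (hμ : 0 < μ) (hε : 0 < ε) :
    ∃ M : Set.Icc (0 : ℝ) 1 → Method n k Q, ∀ p : Set.Icc (0 : ℝ) 1,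
      ((M p).totalCalls : ℝ) ≤ n * max (1000 * ((L / μ) ^ (1 / ((p : ℝ) + 1)) *
          (max 1 ⌈Real.log (μ * R ^ 2 / ε)⌉ : ℤ))) (1000 * (D / (μ * ε))) ∧
      ((M p).iterations : ℝ) ≤ (n : ℝ) / k * (1000 * ((L / μ) ^ (1 / ((p : ℝ) + 1)) *
          (max 1 ⌈Real.log (μ * R ^ 2 / ε)⌉ : ℤ))) ∧
      ∀ (Ξ : Type*) [MeasurableSpace Ξ] (P : Measure Ξ) [IsProbabilityMeasure P]
        (f : Space n → Ξ → ℝ) (δ : ℝ) (ν : Measure (Ξ × (Fin k → ℝ))) [IsProbabilityMeasure ν],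
        IsSmoothStochastic (normSeminorm ℝ (Space n)) Q L D P f →
        StrongConvexOn Q μ (objective P f) → IsOracleLaw k P δ ν →
        δ ≤ √(L / n * (1 / 24 * (ε * (μ / L) ^ ((p : ℝ) / ((p : ℝ) + 1))))) →
        (M p).HasAccuracy P f ν ε := by
  have hN : ∀ x : Space n, ‖x‖ ≤ normSeminorm ℝ (Space n) x := fun x => le_rfl
  obtain ⟨w, v, hwv⟩ := exists_periodicDesign hn hN
  set S : Scheme n := ⟨Q, euclideanProx x₀, x₀, L, μ, strongRate L μ⟩ with hSdef
  have hS : S.Valid (normSeminorm ℝ (Space n)) := by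
    refine ⟨hN, hQc, hQ, hQn, isProxFunction_euclideanProx x₀ Q, hL, hμ.le, Real.sqrt_nonneg _,
      fun x _ z _ => ?_, ?_⟩
    · change 0 ≤ μ * (euclideanProx x₀ z - euclideanProx x₀ x - inner ℝ (x - x₀) (z - x))
      rw [norm_sub_sq_eq_bregman]
      positivity
    · change 2 * L * strongRate L μ ^ 2 ≤ μ
      rw [strongRate_sq hL hμ]
      apply le_of_eq
      field_simp
  set m : ℤ := max 1 ⌈Real.log (μ * R ^ 2 / ε)⌉ with hm
  obtain ⟨l, hl⟩ : ∃ l : ℕ, m = l := Int.eq_ofNat_of_zero_le (zero_le_one.trans (le_max_left _ _))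
  have hl1 : 1 ≤ l := by
    have : 1 ≤ m := le_max_left _ _
    omega
  have hlog : Real.log (μ * R ^ 2 / ε) ≤ l := by
    have h1 : (⌈Real.log (μ * R ^ 2 / ε)⌉ : ℝ) ≤ m := Int.cast_le.2 (le_max_right _ _)
    rw [hl, Int.cast_natCast] at h1
    exact (Int.le_ceil _).trans h1
  rw [hl, Int.cast_natCast]
  -- for `L < μ` only a singleton `Q` carries a problem of the class
  set T : ℕ := if μ ≤ L then strongSteps L μ l else 0 with hT
  set O : ℝ → Calls n k := fun p => ⟨w, v, EuclideanSpace.single ⟨0, hn⟩ 1, by simp,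
    fun t => strongBatch L μ (1 / (p + 1)) D ε T t, ⟨0, hk⟩, rfl⟩ with hO
  refine ⟨fun p => hS.method (O p) T, fun p => ⟨?_, ?_, ?_⟩⟩
  · have hs := half_le_one_div p.2
    change ((hS.method (O p) T).totalCalls : ℝ) ≤ _
    rw [hS.totalCalls_method]
    have h1 : 0 ≤ (L / μ) ^ (1 / ((p : ℝ) + 1)) * l := by positivity
    have h2 : 0 ≤ D / (μ * ε) := by positivity
    have h3 : ∑ t ∈ Finset.range T, ((O p).batch t : ℝ)
        ≤ max (300 * ((L / μ) ^ (1 / ((p : ℝ) + 1)) * l)) (300 * (D / (μ * ε))) := by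
      simp only [hO, hT]
      split_ifs with h
      · exact strong_calls_le hL hμ h hD hε hs hl1
      · rw [Finset.range_zero, Finset.sum_empty]
        exact le_max_of_le_left (by positivity)
    have h4 : max (300 * ((L / μ) ^ (1 / ((p : ℝ) + 1)) * l)) (300 * (D / (μ * ε)))
        ≤ max (1000 * ((L / μ) ^ (1 / ((p : ℝ) + 1)) * l)) (1000 * (D / (μ * ε))) / 2 := by
      rw [le_div_iff₀ two_pos, max_mul_of_nonneg _ _ two_pos.le]
      exact max_le_max (by linarith) (by linarith)
    rw [mul_comm (2 : ℝ), mul_assoc]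
    exact mul_le_mul_of_nonneg_left (by linarith) n.cast_nonneg
  · have hs := half_le_one_div p.2
    change (T : ℝ) ≤ _
    have h2 := mul_le_mul_of_nonneg_right (half_le_div hn hk hkn)
      (by positivity : 0 ≤ 1000 * ((L / μ) ^ (1 / ((p : ℝ) + 1)) * l))
    refine le_trans ?_ h2
    rw [hT]
    split_ifs with h
    · have h3 := mul_le_mul_of_nonneg_right (sqrt_le_rpow ((one_le_div hμ).2 h) hs)
        (l.cast_nonneg (α := ℝ))
      have h4 : 0 ≤ (L / μ) ^ (1 / ((p : ℝ) + 1)) * l := by positivity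
      linarith [strongSteps_le hL hμ h hl1]
    · rw [Nat.cast_zero]; positivity
  · intro Ξ _ P _ f δ ν _ hf hconv hν hδ
    have hs := half_le_one_div p.2
    have hlow : ∀ x ∈ Q, ∀ z ∈ Q, objective P f x + inner ℝ (meanGrad P f x) (z - x)
        + μ / 2 * ‖z - x‖ ^ 2 ≤ objective P f z := fun x hx z hz =>
      hf.objective_ge hN hQc hconv hx hz
    change (hS.method (O p) T).HasAccuracy P f ν ε
    by_cases h : μ ≤ L
    · have hT' : T = strongSteps L μ l := if_pos h
      have hY : n * δ ^ 2 ≤ L * (1 / 24 * (ε * (L / μ) ^ (1 / ((p : ℝ) + 1) - 1))) := by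
        refine hν.mul_sq_le ⟨0, hk⟩ hn hL (by positivity) ?_
        rw [← inv_rpow_div (by positivity) p.2.1, inv_div]
        exact hδ
      refine hS.hasAccuracy (O p) hwv hf hD (hf.model hS fun x hx z hz => ?_) hν hR
        (hT' ▸ strongSteps_pos hL hμ l) (fun t _ => ?_) ?_
      · change _ + μ * (euclideanProx x₀ z - euclideanProx x₀ x - inner ℝ (x - x₀) (z - x)) ≤ _
        rw [norm_sub_sq_eq_bregman]
        linarith [hlow x hx z hz]
      · exact Nat.ceil_pos.2 (lt_max_of_lt_right (by positivity))
      · simp only [hO, hT']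
        exact strong_rate hL hμ h hε hs hl1 hR0 hlog (by positivity) hY
    · have hT' : T = 0 := if_neg h
      rw [hT']
      refine hS.hasAccuracy_zero (O p) hf fun z hz => ?_
      have hu := hS.mirror_mem 0 0
      have h1 := (abs_le.1 (hf.abs_objective_remainder_le hN hQc hu hz)).2
      have h2 := hlow _ hu z hz
      rw [coe_normSeminorm] at h1
      have h3 : (μ - L) * ‖z - S.mirror 0 0‖ ^ 2 ≤ 0 := by linarith
      have h4 : ‖z - S.mirror 0 0‖ ^ 2 ≤ 0 := by
        by_contra! h5
        have := mul_pos (sub_pos.2 (not_le.1 h)) h5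
        linarith
      have h5 : z = S.mirror 0 0 := by
        have : ‖z - S.mirror 0 0‖ = 0 := by
          have := sq_nonneg ‖z - S.mirror 0 0‖
          exact pow_eq_zero_iff two_ne_zero |>.1 (le_antisymm h4 this)
        exact sub_eq_zero.1 (norm_eq_zero.1 this)
      rw [← h5, sub_self]
      exact hε.le

end DirOracle
theorem mainTheorem5 :
    ∃ C c : ℝ, 0 < C ∧ 0 < c ∧
      -- the convex case, for an arbitrary norm and prox-structure
      (∀ (n k : ℕ), 1 ≤ n → 1 ≤ k → k ≤ n + 1 →
        ∀ (N : Seminorm ℝ (DirOracle.Space n)) (Q : Set (DirOracle.Space n))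
          (d : DirOracle.Space n → ℝ) (L D R ε : ℝ),
        (∀ x, ‖x‖ ≤ N x) →
        Convex ℝ Q → IsCompact Q → Q.Nonempty →
        DirOracle.IsProxFunction N Q d → DirOracle.ProxDiameterLE Q d R →
        0 < L → 0 ≤ D → 0 < R → 0 < ε →
        ∃ M : Set.Icc (0 : ℝ) 1 → DirOracle.Method n k Q, ∀ p : Set.Icc (0 : ℝ) 1,
          ((M p).totalCalls : ℝ) ≤
              n * max (C * (L * R ^ 2 / ε) ^ (1 / ((p : ℝ) + 1))) (C * (D * R ^ 2 / ε ^ 2)) ∧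
          ((M p).iterations : ℝ) ≤ (n : ℝ) / k * (C * (L * R ^ 2 / ε) ^ (1 / ((p : ℝ) + 1))) ∧
          ∀ (Ξ : Type*) [MeasurableSpace Ξ] (P : MeasureTheory.Measure Ξ)
            [MeasureTheory.IsProbabilityMeasure P] (f : DirOracle.Space n → Ξ → ℝ) (δ : ℝ)
            (ν : MeasureTheory.Measure (Ξ × (Fin k → ℝ))) [MeasureTheory.IsProbabilityMeasure ν],
            DirOracle.IsSmoothStochastic N Q L D P f →
            ConvexOn ℝ Q (DirOracle.objective P f) →
            (ε ≤ L * R ^ 2 ∨ ∃ x ∈ Q, DirOracle.meanGrad P f x = 0) →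
            DirOracle.IsOracleLaw k P δ ν →
            δ ≤ Real.sqrt (L / n * (c * (ε * (ε / (L * R ^ 2)) ^ ((p : ℝ) / ((p : ℝ) + 1))))) →
            (M p).HasAccuracy P f ν ε) ∧
      -- the strongly convex case, for the Euclidean norm and prox-structure
      (∀ (n k : ℕ), 1 ≤ n → 1 ≤ k → k ≤ n + 1 →
        ∀ (Q : Set (DirOracle.Space n)) (x₀ : DirOracle.Space n) (L D R μ ε : ℝ),
        Convex ℝ Q → IsCompact Q → Q.Nonempty →
        DirOracle.ProxDiameterLE Q (DirOracle.euclideanProx x₀) R →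
        0 < L → 0 ≤ D → 0 < R → 0 < μ → 0 < ε →
        ∃ M : Set.Icc (0 : ℝ) 1 → DirOracle.Method n k Q, ∀ p : Set.Icc (0 : ℝ) 1,
          ((M p).totalCalls : ℝ) ≤
              n * max (C * ((L / μ) ^ (1 / ((p : ℝ) + 1)) *
                  (max 1 ⌈Real.log (μ * R ^ 2 / ε)⌉ : ℤ)))
                (C * (D / (μ * ε))) ∧
          ((M p).iterations : ℝ) ≤
              (n : ℝ) / k * (C * ((L / μ) ^ (1 / ((p : ℝ) + 1)) *
                  (max 1 ⌈Real.log (μ * R ^ 2 / ε)⌉ : ℤ))) ∧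
          ∀ (Ξ : Type*) [MeasurableSpace Ξ] (P : MeasureTheory.Measure Ξ)
            [MeasureTheory.IsProbabilityMeasure P] (f : DirOracle.Space n → Ξ → ℝ) (δ : ℝ)
            (ν : MeasureTheory.Measure (Ξ × (Fin k → ℝ))) [MeasureTheory.IsProbabilityMeasure ν],
            DirOracle.IsSmoothStochastic (normSeminorm ℝ (DirOracle.Space n)) Q L D P f →
            StrongConvexOn Q μ (DirOracle.objective P f) →
            DirOracle.IsOracleLaw k P δ ν →
            δ ≤ Real.sqrt (L / n * (c * (ε * (μ / L) ^ ((p : ℝ) / ((p : ℝ) + 1))))) →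
            (M p).HasAccuracy P f ν ε) := by
  refine ⟨1000, 1 / 24, by norm_num, by norm_num, ?_, ?_⟩
  · intro n k hn hk hkn N Q d L D R ε hN hQc hQ hQn hd hR hL hD hR0 hε
    exact DirOracle.exists_convex_methods hn hk hkn N Q d L D R ε hN hQc hQ hQn hd hR hL hD hR0 hε
  · intro n k hn hk hkn Q x₀ L D R μ ε hQc hQ hQn hR hL hD hR0 hμ hε
    exact DirOracle.exists_strongConvex_methods hn hk hkn Q x₀ L D R μ ε hQc hQ hQn hR hL hD hR0 hμ
      hε
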